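/- Setting. Let $A$ be a sectorial operator on a complex Banach space $X$: a closed (single-valued, not necessarily densely defined or injective) operator for which there is $\theta\in[0,\pi)$ such that $\sigma(A)\subseteq\overline{S_\theta}$ and, for every $\alpha\in(\theta,\pi)$, $\lambda R(\lambda,A)$ is bounded on $\mathbb C\setminus\overline{S_\alpha}$, where $S_\alpha=\{z\ne0:|\arg z|<\alpha\}$ for $\alpha>0$ and $\overline{S_0}=[0,\infty)$. Its sectoriality angle $\omega_{\mathrm{se}}(A)$ is the infimum of these $\theta$. Let $\omega_{\mathrm{se}}(A)<\omega<\pi$. For $\omega_{\mathrm{se}}(A)<\varphi\le\omega$ let $\mathcal E(S_\varphi)$ be the set of bounded holomorphic $e$ on $S_\varphi$ with $\int_{\partial S_\delta}|e(z)|\,|dz|/|z|<\infty$ for all $0\le\delta<\varphi$, and put $\Phi_A^\varphi(e)=\frac1{2\pi i}\int_{\partial S_\delta}e(z)R(z,A)\,dz$ with any $\delta\in(\omega_{\mathrm{se}}(A),\varphi)$. Extend this to $\mathcal E_e(S_\varphi)=\mathcal E(S_\varphi)\oplus\mathbb C\mathbf 1\oplus\mathbb C\frac1{1+\mathbf z}$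 by $\mathbf 1\mapsto I$ and $\frac1{1+\mathbf z}\mapsto(1+A)^{-1}$. A holomorphic function $f$ on $S_\varphi$ belongs to $\operatorname{dom}(\Phi_A^\varphi)$ if $[f]=\{e\in\mathcal E_e(S_\varphi): ef\in\mathcal E_e(S_\varphi)\}$ satisfies $\bigcap_{e\in[f]}\ker\Phi^\varphi_A(e)=\{0\}$; then $\Phi_A^\varphi(f)$ is the closed operator given by $\Phi_A^\varphi(f)x=y$ if and only if $\Phi_A^\varphi(ef)x=\Phi_A^\varphi(e)y$ for all $e\in[f]$. For $f$ holomorphic on $S_\omega$, "$\Phi_A(f)$ is defined and bounded, with value $T\in\mathcal L(X)$" means that $f|_{S_\varphi}\in\operatorname{dom}(\Phi_A^\varphi)$ and $\Phi_A^\varphi(f|_{S_\varphi})=T$ for some $\varphi\in(\omega_{\mathrm{se}}(A),\omega]$. Let $\mathrm H^\infty(S_\omega\cup\{0\})$ be the algebra of bounded holomorphic $f$ on $S_\omega$ for which $f(0):=\lim_{t\searrow0}f(t)$ exists. A sequence $(f_n)$ in it bp-converges to an element $f$ of it if $f_n\to f$ pointwise on $S_\omega\cup\{0\}$ and $\sup_n\|f_n\|_{\infty,S_\omega}<\infty$.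 Commutants are taken in $\mathcal L(X)$; let $\mathcal A_A=\{(1+A)^{-1}\}'$. For $T_n,T\in\mathcal A_A$ write $T_n\xrightarrow{\tau_A^s}T$ if there is a set $\mathcal D\subseteq\mathcal A_A'$ with $\bigcap_{D\in\mathcal D}\ker D=\{0\}$ and $DT_n\to DT$ strongly for every $D\in\mathcal D$. Theorem. (a) Let $(f_n)$ be a sequence in $\mathrm H^\infty(S_\omega\cup\{0\})$ that bp-converges to $0$, such that $\Phi_A(f_n)$ is defined and bounded for every $n$ (no uniform bound is assumed). If $\Phi_A(f_n)\xrightarrow{\tau_A^s}T\in\mathcal A_A$, then $T=0$. (b) The set $\mathcal E$ of all $f\in\mathrm H^\infty(S_\omega\cup\{0\})$ for which $\Phi_A(f)$ is defined and bounded is a unital subalgebra, and $\Phi_A:\mathcal E\to\mathcal L(X)$ is a well-defined unital algebra homomorphism with values in $\mathcal A_A$. It is closable with respect to (bp-convergence on $S_\omega\cup\{0\}$, $\tau_A^s$-convergence in $\mathcal A_A$): if $e_n\in\mathcal E$, $e_n\to0$ in the sense of bp-convergence and $\Phi_A(e_n)\xrightarrow{\tau_A^s}T$, then $T=0$. (c)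 Consequently the bp-extension exists: the set $\mathcal E^{\mathrm{bp}}$ of all $f\in\mathrm H^\infty(S_\omega\cup\{0\})$ for which there are $e_n\in\mathcal E$ and $T\in\mathcal A_A$ such that $(e_n)$ bp-converges to $f$ and $\Phi_A(e_n)\xrightarrow{\tau_A^s}T$ is a unital subalgebra containing $\mathcal E$. Setting $\Phi_A^{\mathrm{bp}}(f):=T$ for every such choice of $(e_n)$ and $T$ gives a well-defined algebra homomorphism $\Phi_A^{\mathrm{bp}}:\mathcal E^{\mathrm{bp}}\to\mathcal L(X)$ that extends $\Phi_A|_{\mathcal E}$. -/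

import Mathlib

open Set Filter Topology MeasureTheory

noncomputable section

namespace SectorialCalculus

/-! ### Sectors and sectorial operators -/

/-- The open sector of half-angle `ω`, for `0 < ω < π`. -/
def sector (ω : ℝ) : Set ℂ := {z | z ≠ 0 ∧ |z.arg| < ω}

/-- The closed sector of half-angle `ω`, vertex included; it is `[0, ∞)` for `ω = 0`. -/
def closedSector (ω : ℝ) : Set ℂ := {z | |z.arg| ≤ ω}

variable {X : Type*} [NormedAddCommGroup X] [NormedSpace ℂ X]

/-- `R` is a bounded two-sided inverse of `z - A`. -/
def IsResolventAt (A : X →ₗ.[ℂ] X) (z : ℂ) (R : X →L[ℂ] X) : Prop :=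
  (∀ y : X, ∃ h : R y ∈ A.domain, z • R y - A ⟨R y, h⟩ = y) ∧
    ∀ x : A.domain, R (z • (x : X) - A x) = x

/-- The resolvent set of an unbounded operator. -/
def resSet (A : X →ₗ.[ℂ] X) : Set ℂ := {z | ∃ R, IsResolventAt A z R}

open Classical in
/-- The resolvent `R(z, A) = (z - A)⁻¹` (zero outside the resolvent set). -/
def resolventOp (A : X →ₗ.[ℂ] X) (z : ℂ) : X →L[ℂ] X :=
  if h : ∃ R, IsResolventAt A z R then h.choose else 0

/-- `σ(A)` lies in the closed sector of half-angle `θ`, and `z R(z, A)` is uniformly bounded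
outside every larger sector. -/
def IsSectorialOfAngle (A : X →ₗ.[ℂ] X) (θ : ℝ) : Prop :=
  0 ≤ θ ∧ θ < Real.pi ∧ (resSet A)ᶜ ⊆ closedSector θ ∧
    ∀ α, θ < α → α < Real.pi → ∃ C : ℝ, ∀ z ∉ closedSector α, ‖z • resolventOp A z‖ ≤ C

/-- Sectorial operators: closed, neither densely defined nor injective in general. -/
def IsSectorial (A : X →ₗ.[ℂ] X) : Prop :=
  A.IsClosed ∧ ∃ θ, IsSectorialOfAngle A θ

/-- The sectoriality angle `ω_se(A)`. -/
def sectorialityAngle (A : X →ₗ.[ℂ] X) : ℝ := sInf {θ | IsSectorialOfAngle A θ}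

/-- `(1 + A)⁻¹ = -R(-1, A)`. -/
def invOneAdd (A : X →ₗ.[ℂ] X) : X →L[ℂ] X := -resolventOp A (-1)

/-! ### Function classes

Functions on a sector `S`, or on `S ∪ {0}`, are represented by functions `ℂ → ℂ`; every notion
below depends only on the values on `S`, or on `S ∪ {0}`. -/

/-- Bounded holomorphic functions on the open sector. -/
def MemHInf (ω : ℝ) (f : ℂ → ℂ) : Prop :=
  DifferentiableOn ℂ f (sector ω) ∧ ∃ C : ℝ, ∀ z ∈ sector ω, ‖f z‖ ≤ C

/-- `H^∞(S_ω ∪ {0})`: bounded holomorphic functions on the sector which have a limit at `0` along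
the positive reals, this limit being the value at `0`. -/
def MemHInfZero (ω : ℝ) (f : ℂ → ℂ) : Prop :=
  MemHInf ω f ∧ Tendsto (fun t : ℝ => f (t : ℂ)) (𝓝[>] 0) (𝓝 (f 0))

/-- The point `t e^{iδ}`. -/
def ray (δ t : ℝ) : ℂ := (t : ℂ) * Complex.exp ((δ : ℂ) * Complex.I)

/-- The algebra `𝓔(S_ω)`: bounded holomorphic functions that are absolutely integrable with
respect to `|dz| / |z|` along the boundary of every smaller sector (including the degenerate
one, `δ = 0`). -/
def MemE (ω : ℝ) (e : ℂ → ℂ) : Prop :=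
  MemHInf ω e ∧
    ∀ δ : ℝ, |δ| < ω → IntegrableOn (fun t : ℝ => e (ray δ t) / (t : ℂ)) (Ioi 0)

/-! ### The elementary calculus -/

/-- `(2πi)⁻¹ ∫ e(z) R(z, A) dz` over the positively oriented boundary of the sector of
half-angle `δ`: out along `e^{-iδ} ℝ₊`, back along `e^{iδ} ℝ₊`. -/
def contourIntegral (A : X →ₗ.[ℂ] X) (δ : ℝ) (e : ℂ → ℂ) : X →L[ℂ] X :=
  (2 * (Real.pi : ℂ) * Complex.I)⁻¹ •
    ((∫ t in Ioi (0 : ℝ), (e (ray (-δ) t) * ray (-δ) 1) • resolventOp A (ray (-δ) t)) -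
      ∫ t in Ioi (0 : ℝ), (e (ray δ t) * ray δ 1) • resolventOp A (ray δ t))

/-- The Cauchy integral defining `Φ_A^ω(e)` for `e ∈ 𝓔(S_ω)`. The result is the same for all
`δ` strictly between the sectoriality angle and `ω`; the midpoint is used. -/
def cauchyCalc (A : X →ₗ.[ℂ] X) (ω : ℝ) (e : ℂ → ℂ) : X →L[ℂ] X :=
  contourIntegral A ((sectorialityAngle A + ω) / 2) e

/-- The graph of the elementary calculus on `𝓔_e(S_ω) = 𝓔(S_ω) ⊕ ℂ 1 ⊕ ℂ (1 + z)⁻¹`: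
`f = e + c + d (1 + z)⁻¹` is sent to `Φ_A^ω(e) + c I + d (1 + A)⁻¹`. -/
def ElemCalc (A : X →ₗ.[ℂ] X) (ω : ℝ) (f : ℂ → ℂ) (B : X →L[ℂ] X) : Prop :=
  ∃ (e : ℂ → ℂ) (c d : ℂ), MemE ω e ∧ (∀ z ∈ sector ω, f z = e z + c + d * (1 + z)⁻¹) ∧
    B = cauchyCalc A ω e + c • (1 : X →L[ℂ] X) + d • invOneAdd A

/-! ### The algebraic extension -/

/-- `f` is anchored in `𝓔_e(S_ω)`: the operators `Φ(e)`, for `e ∈ 𝓔_e` with `e f ∈ 𝓔_e`, have no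
common kernel. (The set of these `e` always contains `0`.) -/
def IsAnchored (A : X →ₗ.[ℂ] X) (ω : ℝ) (f : ℂ → ℂ) : Prop :=
  ∀ x : X, (∀ e B C, ElemCalc A ω e B → ElemCalc A ω (e * f) C → B x = 0) → x = 0

/-- For a holomorphic `f` on the sector, `f` belongs to the domain of the algebraically extended
calculus and `Φ_A^ω(f) x = y`, that is, `Φ(e f) x = Φ(e) y` for all `e ∈ 𝓔_e` with
`e f ∈ 𝓔_e`. -/
def ExtCalcGraph (A : X →ₗ.[ℂ] X) (ω : ℝ) (f : ℂ → ℂ) (x y : X) : Prop :=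
  DifferentiableOn ℂ f (sector ω) ∧ IsAnchored A ω f ∧
    ∀ e B C, ElemCalc A ω e B → ElemCalc A ω (e * f) C → C x = B y

/-- For a function `f` on the sector of half-angle `ω`: `Φ_A(f)` is defined, and it is the bounded
operator `T`. The sectorial calculus `Φ_A` is the inductive limit of the calculi `Φ_A^φ` as `φ`
decreases to the sectoriality angle, so `f` may be restricted to any smaller sector of half-angle
still larger than the sectoriality angle. -/
def SectCalc (A : X →ₗ.[ℂ] X) (ω : ℝ) (f : ℂ → ℂ) (T : X →L[ℂ] X) : Prop :=
  ∃ φ, sectorialityAngle A < φ ∧ φ ≤ ω ∧ ∀ x y, ExtCalcGraph A φ f x y ↔ T x = y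

/-! ### The joint convergence structure -/

/-- Pointwise and bounded convergence on `S_ω ∪ {0}` within `H^∞(S_ω ∪ {0})`. -/
def BPConv (ω : ℝ) (f : ℕ → ℂ → ℂ) (g : ℂ → ℂ) : Prop :=
  (∀ n, MemHInfZero ω (f n)) ∧ MemHInfZero ω g ∧
    (∀ z ∈ insert 0 (sector ω), Tendsto (fun n => f n z) atTop (𝓝 (g z))) ∧
    ∃ C : ℝ, ∀ n, ∀ z ∈ sector ω, ‖f n z‖ ≤ C

/-- The commutant `𝓐_A` of `(1 + A)⁻¹` in the bounded operators. -/
def commutant (A : X →ₗ.[ℂ] X) : Set (X →L[ℂ] X) := Set.centralizer {invOneAdd A}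

/-- `τ_A^s`-convergence of sequences in `𝓐_A`: there is a point-separating set `𝓓` in the commutant
of `𝓐_A` with `D Tₙ → D T` strongly for all `D ∈ 𝓓`. -/
def TauConv (A : X →ₗ.[ℂ] X) (T : ℕ → X →L[ℂ] X) (S : X →L[ℂ] X) : Prop :=
  (∀ n, T n ∈ commutant A) ∧ S ∈ commutant A ∧
    ∃ 𝓓 ⊆ Set.centralizer (commutant A),
      (∀ x : X, (∀ D ∈ 𝓓, D x = 0) → x = 0) ∧
      ∀ D ∈ 𝓓, ∀ x : X, Tendsto (fun n => D (T n x)) atTop (𝓝 (D (S x)))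

/-! ### Closability and topological extensions of a representation -/

/-- `Φ` is closable with respect to the joint sequential convergence structure `(τ₁, τ₂)`. -/
def IsClosableWrt {F B : Type*} [Ring F] [Algebra ℂ F] [Ring B] [Algebra ℂ B]
    {E : Subalgebra ℂ F} (Φ : E →ₐ[ℂ] B) (τ₁ : (ℕ → F) → F → Prop) (τ₂ : (ℕ → B) → B → Prop) :
    Prop :=
  ∀ (e : ℕ → E) (T : B), τ₁ (fun n => (e n : F)) 0 → τ₂ (fun n => Φ (e n)) T → T = 0

/-- `Ψ : E' → B` is the topological extension of `Φ : E → B`: its domain consists of all `f` for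
which there are `eₙ ∈ E` and `T` with `eₙ → f` (`τ₁`) and `Φ(eₙ) → T` (`τ₂`), its value at `f` is
the operator `T` for every such choice, and it extends `Φ`. -/
def IsTopExtension {F B : Type*} [Ring F] [Algebra ℂ F] [Ring B] [Algebra ℂ B]
    {E E' : Subalgebra ℂ F} (Φ : E →ₐ[ℂ] B) (Ψ : E' →ₐ[ℂ] B)
    (τ₁ : (ℕ → F) → F → Prop) (τ₂ : (ℕ → B) → B → Prop) : Prop :=
  (∀ f : F, f ∈ E' ↔
    ∃ (e : ℕ → E) (T : B), τ₁ (fun n => (e n : F)) f ∧ τ₂ (fun n => Φ (e n)) T) ∧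
  (∀ (f : E') (e : ℕ → E) (T : B),
    τ₁ (fun n => (e n : F)) f → τ₂ (fun n => Φ (e n)) T → Ψ f = T) ∧
  ∃ h : E ≤ E', ∀ f : E, Ψ (Subalgebra.inclusion h f) = Φ f

end SectorialCalculus

end

open SectorialCalculus

/-!
The calculus is studied in the logarithmic coordinate `v = log z`, in which sectors become
horizontal strips, the boundary of a sector becomes a pair of horizontal lines, and `R(z, A) dz`
becomes `z R(z, A) dv` with a bounded operator-valued function `z R(z, A)`.

*The elementary calculus is a homomorphism.* Elements of `𝓔` are only assumed to be bounded and to be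
integrable on each ray, so that no uniform decay is available for shifting contours. Multiplying by
the Gaussian `exp (-ε v²)`, which is bounded on strips, and letting `ε → 0` by dominated convergence
on the two boundary lines is enough (`integral_horiz_eq`). This yields the independence of the
contour (`contourIntegral_eq_of_le`), the Cauchy formula (`MemE.cauchy_formula`) and hence, by the
resolvent identity and Fubini, `Φ(e f) = Φ(e) Φ(f)` on `𝓔` (`cauchyCalc_mul`). Together with
`Φ(e / (1 + z)) = Φ(e) (1 + A)⁻¹` and `Φ(z / (1 + z)²) = (1 + A)⁻¹ - (1 + A)⁻²`
(`cauchyCalc_qFun`) this gives multiplicativity on `𝓔 ⊕ ℂ 1 ⊕ ℂ (1 + z)⁻¹` (`ElemCalc.mul`). The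
passage to the algebraic extension, and from one sector to a smaller one, is then purely algebraic:
an operator identity holds as soon as it holds after applying a point-separating family of anchor
operators (`bddCalc_of_separating`).

*Closability* (`eq_zero_of_bpConv_zero`). Write `B = (1 + A)⁻¹` and let `fₙ → 0` boundedly and
pointwise, with `Φ(fₙ) = Tₙ → T`. The function `q = z / (1 + z)²` regularizes all `fₙ` at once, and
`Φ(q) Tₙ = Φ(q fₙ) → 0` in norm by dominated convergence. Hence `Φ(q) T = 0`, which means that the
range of `T` consists of fixed vectors of `B`, that is, lies in the kernel of `A`. If this kernel is
trivial, then `T = 0`. Otherwise some anchor element of `fₙ` does not vanish at `0`, since elements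
of `𝓔` act as `0` on the kernel; dividing by it shows that `gₙ = (fₙ - fₙ(0)) / (1 + z)` belongs to
`𝓔` (`BddCalc.memE_of_fixed`), so that `B Tₙ - fₙ(0) B = Φ(gₙ)`. On the range of `Φ(gₙ)` the operators
`t (t + A)⁻¹` tend to `0` strongly as `t ↘ 0`, and this property survives the limit `n → ∞`, in which
`fₙ(0) → 0`. So for `D` in the bicommutant `t (t + A)⁻¹ D T x → 0`, whereas `t (t + A)⁻¹` is the
identity on the kernel of `A`, which contains `D T x`. Therefore `D T x = 0`.

The extension theorem is the usual consequence of closability, because both convergence notions are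
compatible with sums and products: two point-separating subsets of the (commutative) bicommutant may
be replaced by the set of their products, and strongly convergent sequences are bounded.
-/

noncomputable section

namespace SectorialCalculus

/-! ### Resolvents -/

section Resolvent

variable {X : Type*} [NormedAddCommGroup X] [NormedSpace ℂ X] {A : X →ₗ.[ℂ] X}

lemma isResolventAt_resolventOp {z : ℂ} (hz : z ∈ resSet A) :
    IsResolventAt A z (resolventOp A z) := by
  have hex : ∃ R, IsResolventAt A z R := hz
  rw [resolventOp, dif_pos hex]
  exact hex.choose_spec

/-- The first resolvent identity. -/
lemma resolventOp_sub {z w : ℂ} (hz : z ∈ resSet A) (hw : w ∈ resSet A) :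
    resolventOp A z - resolventOp A w = (w - z) • (resolventOp A z * resolventOp A w) := by
  have h1 := isResolventAt_resolventOp hz
  have h2 := isResolventAt_resolventOp hw
  ext y
  obtain ⟨hy, e⟩ := h2.1 y
  have h3 := h1.2 ⟨resolventOp A w y, hy⟩
  have h4 : z • resolventOp A w y - A ⟨resolventOp A w y, hy⟩
      = y - (w - z) • resolventOp A w y := by
    rw [sub_smul, sub_eq_iff_eq_add.1 e]
    abel
  simp only at h3
  rw [h4, map_sub, map_smul] at h3
  change resolventOp A z y - resolventOp A w y
    = (w - z) • resolventOp A z (resolventOp A w y)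
  rw [sub_eq_iff_eq_add, ← sub_eq_iff_eq_add']
  exact h3

lemma resolventOp_commute {z w : ℂ} (hz : z ∈ resSet A) (hw : w ∈ resSet A) :
    Commute (resolventOp A z) (resolventOp A w) := by
  rcases eq_or_ne z w with rfl | hne
  · exact Commute.refl _
  have h1 := resolventOp_sub hz hw
  have h2 := resolventOp_sub hw hz
  have h3 : (w - z) • (resolventOp A z * resolventOp A w)
      = (w - z) • (resolventOp A w * resolventOp A z) := by
    rw [← h1, ← neg_sub z w, neg_smul, ← h2, neg_sub]
  exact smul_right_injective _ (sub_ne_zero.2 hne.symm) h3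

/-- Where the resolvent is locally bounded it is holomorphic. -/
lemma hasDerivAt_resolventOp {U : Set ℂ} {z : ℂ} (hU : U ∈ 𝓝 z) (hres : U ⊆ resSet A)
    {M : ℝ} (hM : ∀ w ∈ U, ‖resolventOp A w‖ ≤ M) :
    HasDerivAt (resolventOp A) (-(resolventOp A z * resolventOp A z)) z := by
  have hz : z ∈ U := mem_of_mem_nhds hU
  have hcont : Tendsto (resolventOp A) (𝓝 z) (𝓝 (resolventOp A z)) := by
    rw [tendsto_iff_norm_sub_tendsto_zero]
    have h0 : Tendsto (fun w : ℂ => ‖z - w‖ * (M * M)) (𝓝 z) (𝓝 0) := by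
      have : Tendsto (fun w : ℂ => ‖z - w‖ * (M * M)) (𝓝 z) (𝓝 (‖z - z‖ * (M * M))) := by
        apply Continuous.tendsto
        fun_prop
      simpa using this
    refine squeeze_zero' (Eventually.of_forall fun _ => norm_nonneg _) ?_ h0
    filter_upwards [hU] with w hw
    rw [resolventOp_sub (hres hw) (hres hz), norm_smul]
    have hM0 : 0 ≤ M := (norm_nonneg _).trans (hM z hz)
    gcongr
    exact (norm_mul_le _ _).trans (mul_le_mul (hM w hw) (hM z hz) (norm_nonneg _) hM0)
  rw [hasDerivAt_iff_tendsto_slope]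
  have h1 : Tendsto (fun w => -(resolventOp A w * resolventOp A z)) (𝓝[≠] z)
      (𝓝 (-(resolventOp A z * resolventOp A z))) :=
    ((hcont.mul_const _).neg).mono_left nhdsWithin_le_nhds
  refine h1.congr' ?_
  filter_upwards [self_mem_nhdsWithin, mem_nhdsWithin_of_mem_nhds hU] with w hw hwU
  rw [slope_def_module, resolventOp_sub (hres hwU) (hres hz), smul_smul, ← neg_sub w z,
    mul_neg, inv_mul_cancel₀ (sub_ne_zero.2 hw), neg_one_smul]

end Resolvent

/-! ### Sectorial operators -/

lemma continuousAt_abs_arg {z : ℂ} (hz : z ≠ 0) : ContinuousAt (fun w : ℂ => |w.arg|) z := by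
  have h : (fun w : ℂ => InnerProductGeometry.angle 1 w) =ᶠ[𝓝 z] fun w : ℂ => |w.arg| := by
    filter_upwards [isOpen_ne.mem_nhds hz] with w hw
    exact Complex.angle_one_left hw
  refine ContinuousAt.congr ?_ h
  exact (InnerProductGeometry.continuousAt_angle (x := ((1 : ℂ), z)) one_ne_zero hz).comp
    (f := fun w : ℂ => ((1 : ℂ), w)) (by fun_prop)

section Sectorial

variable {X : Type*} [NormedAddCommGroup X] [NormedSpace ℂ X] {A : X →ₗ.[ℂ] X}

lemma sectorialityAngle_nonneg (A : X →ₗ.[ℂ] X) : 0 ≤ sectorialityAngle A :=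
  Real.sInf_nonneg fun _ h => h.1

lemma exists_isSectorialOfAngle_lt (hA : IsSectorial A) {α : ℝ} (hα : sectorialityAngle A < α) :
    ∃ θ < α, IsSectorialOfAngle A θ := by
  obtain ⟨θ, h1, h2⟩ := exists_lt_of_csInf_lt hA.2 hα
  exact ⟨θ, h2, h1⟩

lemma mem_resSet_of_lt_abs_arg (hA : IsSectorial A) {z : ℂ}
    (hz : sectorialityAngle A < |z.arg|) : z ∈ resSet A := by
  obtain ⟨θ, h1, h2⟩ := exists_isSectorialOfAngle_lt hA hz
  by_contra h
  exact absurd (h2.2.2.1 h) (not_le.2 h1)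

lemma exists_norm_smul_resolventOp_le (hA : IsSectorial A) {α : ℝ}
    (hα : sectorialityAngle A < α) (hαπ : α < Real.pi) :
    ∃ C : ℝ, 0 ≤ C ∧ ∀ z : ℂ, α < |z.arg| → ‖z • resolventOp A z‖ ≤ C := by
  obtain ⟨θ, h1, h2⟩ := exists_isSectorialOfAngle_lt hA hα
  obtain ⟨C, hC⟩ := h2.2.2.2 α h1 hαπ
  refine ⟨max C 0, le_max_right _ _, fun z hz => (hC z ?_).trans (le_max_left _ _)⟩
  simpa [closedSector] using hz

lemma differentiableAt_resolventOp (hA : IsSectorial A) {z : ℂ}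
    (hz : sectorialityAngle A < |z.arg|) : DifferentiableAt ℂ (resolventOp A) z := by
  have hz0 : z ≠ 0 := by
    rintro rfl
    simp at hz
    exact absurd hz (not_lt.2 (sectorialityAngle_nonneg A))
  obtain ⟨α, hα1, hα2⟩ := exists_between hz
  obtain ⟨C, hC0, hC⟩ := exists_norm_smul_resolventOp_le hA hα1
    (hα2.trans_le (Complex.abs_arg_le_pi z))
  have hz1 : 0 < ‖z‖ := norm_pos_iff.2 hz0
  have hU : {w : ℂ | α < |w.arg| ∧ ‖z‖ / 2 < ‖w‖} ∈ 𝓝 z := by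
    refine Filter.inter_mem ?_ ?_
    · exact (continuousAt_abs_arg hz0).eventually (lt_mem_nhds hα2)
    · exact continuous_norm.continuousAt.eventually (lt_mem_nhds (half_lt_self hz1))
  refine (hasDerivAt_resolventOp (M := C / (‖z‖ / 2)) hU
    (fun w hw => mem_resSet_of_lt_abs_arg hA (hα1.trans hw.1)) ?_).differentiableAt
  rintro w ⟨hw1, hw2⟩
  rw [le_div_iff₀ (by positivity)]
  calc ‖resolventOp A w‖ * (‖z‖ / 2) ≤ ‖resolventOp A w‖ * ‖w‖ := by gcongr
    _ = ‖w • resolventOp A w‖ := by rw [norm_smul, mul_comm]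
    _ ≤ C := hC w hw1

end Sectorial

/-! ### Shifting integrals between horizontal lines -/

/-- The point `x + i y`, as a parametrization by `x` of the horizontal line at height `y`. -/
def horiz (y x : ℝ) : ℂ := (x : ℂ) + (y : ℂ) * Complex.I

@[simp] lemma horiz_re (y x : ℝ) : (horiz y x).re = x := by simp [horiz]

@[simp] lemma horiz_im (y x : ℝ) : (horiz y x).im = y := by simp [horiz]

@[fun_prop]
lemma continuous_horiz (y : ℝ) : Continuous (horiz y) := by
  unfold horiz; fun_prop

section Shift

variable {Y : Type*} [NormedAddCommGroup Y] [NormedSpace ℂ Y]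

lemma integral_horiz_eq_of_tendsto_zero {h : ℂ → Y} {a b : ℝ} (hab : a ≤ b)
    (hd : ∀ v : ℂ, v.im ∈ Icc a b → DifferentiableAt ℂ h v) {g : ℝ → ℝ}
    (hg : ∀ v : ℂ, v.im ∈ Icc a b → ‖h v‖ ≤ g v.re)
    (hg1 : Tendsto g atTop (𝓝 0)) (hg2 : Tendsto g atBot (𝓝 0))
    (ha : Integrable fun x => h (horiz a x)) (hb : Integrable fun x => h (horiz b x)) :
    ∫ x, h (horiz a x) = ∫ x, h (horiz b x) := by
  have hrect : ∀ R : ℝ, (∫ x in (-R)..R, h (horiz a x)) - (∫ x in (-R)..R, h (horiz b x)) =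
      Complex.I • (∫ y in a..b, h (horiz y (-R))) - Complex.I • (∫ y in a..b, h (horiz y R)) := by
    intro R
    have := Complex.integral_boundary_rect_eq_zero_of_differentiableOn h (horiz a (-R)) (horiz b R)
      (fun v hv => by
        have h2 : v.im ∈ uIcc a b := by simpa using hv.2
        rw [uIcc_of_le hab] at h2
        exact (hd v h2).differentiableWithinAt)
    simp only [horiz_re, horiz_im] at this
    rw [← sub_eq_zero, ← this]
    simp only [horiz]
    abel
  have hvert : ∀ s : ℝ, ‖Complex.I • ∫ y in a..b, h (horiz y s)‖ ≤ g s * |b - a| := by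
    intro s
    rw [norm_smul, Complex.norm_I, one_mul]
    refine intervalIntegral.norm_integral_le_of_norm_le_const fun y hy => ?_
    rw [uIoc_of_le hab] at hy
    simpa using hg (horiz y s) (by simpa using ⟨hy.1.le, hy.2⟩)
  have hv1 : Tendsto (fun R : ℝ => Complex.I • ∫ y in a..b, h (horiz y R)) atTop (𝓝 0) :=
    squeeze_zero_norm hvert (by simpa using hg1.mul_const |b - a|)
  have hv2 : Tendsto (fun R : ℝ => Complex.I • ∫ y in a..b, h (horiz y (-R))) atTop (𝓝 0) :=
    squeeze_zero_norm (fun R => hvert (-R))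
      (by simpa using (hg2.comp tendsto_neg_atTop_atBot).mul_const |b - a|)
  have h1 := (intervalIntegral_tendsto_integral ha tendsto_neg_atTop_atBot tendsto_id).sub
    (intervalIntegral_tendsto_integral hb tendsto_neg_atTop_atBot tendsto_id)
  have h2 := hv2.sub hv1
  rw [sub_zero] at h2
  exact sub_eq_zero.1 (tendsto_nhds_unique (h1.congr hrect) h2)

/-- The integrals of a bounded holomorphic function along the two boundary lines of a horizontal
strip agree as soon as both converge absolutely. No decay inside the strip is assumed: the function
is multiplied by the Gaussian `exp (-ε v²)`, which is bounded on the strip, and `ε` tends to `0` by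
dominated convergence on the two lines. -/
lemma integral_horiz_eq {h : ℂ → Y} {a b : ℝ} (hab : a ≤ b)
    (hd : ∀ v : ℂ, v.im ∈ Icc a b → DifferentiableAt ℂ h v) {C : ℝ}
    (hC : ∀ v : ℂ, v.im ∈ Icc a b → ‖h v‖ ≤ C)
    (ha : Integrable fun x => h (horiz a x)) (hb : Integrable fun x => h (horiz b x)) :
    ∫ x, h (horiz a x) = ∫ x, h (horiz b x) := by
  set M : ℝ := max |a| |b| with hM
  have him : ∀ v : ℂ, v.im ∈ Icc a b → v.im ^ 2 ≤ M ^ 2 := fun v hv => by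
    rw [← sq_abs]
    have : |v.im| ≤ M := abs_le_max_abs_abs hv.1 hv.2
    gcongr
  let k : ℕ → ℂ → ℂ := fun n v => Complex.exp (-((1 / ((n : ℝ) + 1) : ℝ) : ℂ) * v ^ 2)
  have hk : ∀ n v, ‖k n v‖ = Real.exp (-(1 / ((n : ℝ) + 1)) * (v.re ^ 2 - v.im ^ 2)) := by
    intro n v
    simp only [k, Complex.norm_exp]
    congr 1
    rw [← Complex.ofReal_neg, Complex.re_ofReal_mul, pow_two, Complex.mul_re]
    ring
  have hε : ∀ n : ℕ, 0 < 1 / ((n : ℝ) + 1) := fun n => by positivity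
  have hε1 : ∀ n : ℕ, 1 / ((n : ℝ) + 1) ≤ 1 := fun n => by
    rw [div_le_one (by positivity)]
    have : (0 : ℝ) ≤ n := n.cast_nonneg
    linarith
  have hk1 : ∀ n v, v.im ∈ Icc a b →
      ‖k n v‖ ≤ Real.exp (M ^ 2) * Real.exp (-(1 / ((n : ℝ) + 1)) * v.re ^ 2) := by
    intro n v hv
    rw [hk, ← Real.exp_add]
    apply Real.exp_le_exp.2
    have := mul_le_mul (hε1 n) (him v hv) (sq_nonneg _) zero_le_one
    linarith
  have hk2 : ∀ n v, v.im ∈ Icc a b → ‖k n v‖ ≤ Real.exp (M ^ 2) := by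
    intro n v hv
    refine (hk1 n v hv).trans (mul_le_of_le_one_right (Real.exp_nonneg _) ?_)
    rw [Real.exp_le_one_iff]
    nlinarith [hε n, sq_nonneg v.re]
  have hkc : ∀ n, Differentiable ℂ (k n) := by
    intro n
    simp only [k]
    fun_prop
  have hklim : ∀ v, Tendsto (fun n => k n v) atTop (𝓝 1) := by
    intro v
    have h0 : Tendsto (fun n : ℕ => (((1 / ((n : ℝ) + 1) : ℝ)) : ℂ)) atTop (𝓝 ((0 : ℝ) : ℂ)) :=
      (Complex.continuous_ofReal.tendsto _).comp tendsto_one_div_add_atTop_nhds_zero_nat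
    have h1 : Tendsto (fun n => k n v) atTop (𝓝 (Complex.exp (-((0 : ℝ) : ℂ) * v ^ 2))) :=
      (Complex.continuous_exp.tendsto _).comp (h0.neg.mul_const _)
    simpa using h1
  have hmeas : ∀ n y, Continuous fun x : ℝ => k n (horiz y x) := fun n y =>
    (hkc n).continuous.comp (continuous_horiz y)
  have hint : ∀ n y, y ∈ Icc a b → Integrable (fun x => h (horiz y x)) →
      Integrable fun x => k n (horiz y x) • h (horiz y x) := fun n y hy hi =>
    hi.bdd_smul (Real.exp (M ^ 2)) (hmeas n y).aestronglyMeasurable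
      (Eventually.of_forall fun x => hk2 n (horiz y x) (by simpa using hy))
  have hlim : ∀ y, y ∈ Icc a b → Integrable (fun x => h (horiz y x)) →
      Tendsto (fun n => ∫ x, k n (horiz y x) • h (horiz y x)) atTop
        (𝓝 (∫ x, h (horiz y x))) := by
    intro y hy hi
    refine tendsto_integral_of_dominated_convergence
      (fun x => Real.exp (M ^ 2) * ‖h (horiz y x)‖) (fun n => (hint n y hy hi).1)
      (hi.norm.const_mul _) (fun n => Eventually.of_forall fun x => ?_)
      (Eventually.of_forall fun x => ?_)
    · rw [norm_smul]
      gcongr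
      exact hk2 n _ (by simpa using hy)
    · simpa using (hklim (horiz y x)).smul_const (h (horiz y x))
  have hC0 : 0 ≤ C := (norm_nonneg _).trans (hC (horiz a 0) (by simpa using hab))
  have heq : ∀ n, ∫ x, k n (horiz a x) • h (horiz a x) = ∫ x, k n (horiz b x) • h (horiz b x) := by
    intro n
    have hgauss : Tendsto (fun t : ℝ => Real.exp (-(1 / ((n : ℝ) + 1)) * t)) atTop (𝓝 0) :=
      Real.tendsto_exp_atBot.comp (tendsto_id.const_mul_atTop_of_neg (neg_lt_zero.2 (hε n)))
    have hg : ∀ l : Filter ℝ, Tendsto (fun s : ℝ => s ^ 2) l atTop →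
        Tendsto (fun s : ℝ => Real.exp (M ^ 2) * Real.exp (-(1 / ((n : ℝ) + 1)) * s ^ 2) * C)
          l (𝓝 0) := fun l hl => by
      simpa using ((hgauss.comp hl).const_mul (Real.exp (M ^ 2))).mul_const C
    refine integral_horiz_eq_of_tendsto_zero (h := fun v => k n v • h v) hab
      (fun v hv => (hkc n v).smul (hd v hv))
      (g := fun s => Real.exp (M ^ 2) * Real.exp (-(1 / ((n : ℝ) + 1)) * s ^ 2) * C)
      (fun v hv => ?_) (hg _ (tendsto_pow_atTop two_ne_zero)) (hg _ ?_)
      (hint n a ⟨le_rfl, hab⟩ ha) (hint n b ⟨hab, le_rfl⟩ hb)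
    · rw [norm_smul]
      exact mul_le_mul (hk1 n v hv) (hC v hv) (norm_nonneg _) (by positivity)
    · have := (tendsto_pow_atTop (α := ℝ) two_ne_zero).comp tendsto_neg_atBot_atTop
      simpa [Function.comp_def] using this
  exact tendsto_nhds_unique ((hlim a ⟨le_rfl, hab⟩ ha).congr heq) (hlim b ⟨hab, le_rfl⟩ hb)

end Shift

/-! ### Logarithmic coordinates -/

lemma arg_exp {v : ℂ} (h : |v.im| < Real.pi) : (Complex.exp v).arg = v.im := by
  rw [← Complex.log_im, Complex.log_exp (abs_lt.1 h).1 (abs_lt.1 h).2.le]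

lemma exp_mem_sector {v : ℂ} {φ : ℝ} (h : |v.im| < φ) (hφ : φ < Real.pi) :
    Complex.exp v ∈ sector φ :=
  ⟨Complex.exp_ne_zero v, by rwa [arg_exp (h.trans hφ)]⟩

lemma lt_abs_arg_exp {v : ℂ} {α : ℝ} (hα : 0 ≤ α) (h : α < |v.im|) (h' : |v.im| < 2 * Real.pi - α) :
    α < |(Complex.exp v).arg| := by
  have key : ∀ w : ℂ, α < w.im → w.im < 2 * Real.pi - α → 0 ≤ w.im →
      α < |(Complex.exp w).arg| := by
    intro w h1 h2 h3
    rcases le_or_gt w.im Real.pi with h4 | h4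
    · rw [← Complex.log_im, Complex.log_exp (by linarith [Real.pi_pos]) h4]
      exact h1.trans_le (le_abs_self _)
    · have h5 : Complex.exp w = Complex.exp (w - 2 * Real.pi * Complex.I) := by
        rw [Complex.exp_sub, Complex.exp_two_pi_mul_I, div_one]
      have h6 : (w - 2 * Real.pi * Complex.I).im = w.im - 2 * Real.pi := by simp
      rw [h5, arg_exp (by rw [h6, abs_lt]; constructor <;> linarith), h6]
      rw [abs_of_nonpos (by linarith)]
      linarith
  rcases le_total 0 v.im with h0 | h0
  · rw [abs_of_nonneg h0] at h h'
    exact key v h h' h0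
  · rw [abs_of_nonpos h0] at h h'
    have h1 := key (starRingEnd ℂ v) (by simpa using h) (by simpa using h') (by simpa using h0)
    rw [Complex.exp_conj, Complex.arg_conj] at h1
    split_ifs at h1 with h2
    · rwa [h2]
    · rwa [abs_neg] at h1

lemma isOpen_sector (φ : ℝ) : IsOpen (sector φ) := by
  rw [isOpen_iff_mem_nhds]
  rintro z ⟨hz, hzφ⟩
  filter_upwards [isOpen_ne.mem_nhds hz, (continuousAt_abs_arg hz).eventually (gt_mem_nhds hzφ)]
    with w h1 h2 using ⟨h1, h2⟩

lemma sector_mono {φ ψ : ℝ} (h : φ ≤ ψ) : sector φ ⊆ sector ψ := fun _ hz => ⟨hz.1, hz.2.trans_le h⟩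

lemma ray_exp (δ x : ℝ) : ray δ (Real.exp x) = Complex.exp (horiz δ x) := by
  rw [ray, horiz, Complex.exp_add, Complex.ofReal_exp]

lemma integral_Ioi_eq_integral_exp {Y : Type*} [NormedAddCommGroup Y] [NormedSpace ℝ Y]
    (g : ℝ → Y) : ∫ t in Ioi (0 : ℝ), g t = ∫ x, Real.exp x • g (Real.exp x) := by
  have h := integral_image_eq_integral_abs_deriv_smul (s := univ) (f := Real.exp) (f' := Real.exp)
    MeasurableSet.univ (fun x _ => (Real.hasDerivAt_exp x).hasDerivWithinAt)
    Real.exp_injective.injOn g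
  simpa [image_univ, Real.range_exp] using h

lemma integrableOn_Ioi_iff_exp {Y : Type*} [NormedAddCommGroup Y] [NormedSpace ℝ Y]
    (g : ℝ → Y) : IntegrableOn g (Ioi 0) ↔ Integrable fun x => Real.exp x • g (Real.exp x) := by
  have h := integrableOn_image_iff_integrableOn_abs_deriv_smul (s := univ) (f := Real.exp)
    (f' := Real.exp) MeasurableSet.univ (fun x _ => (Real.hasDerivAt_exp x).hasDerivWithinAt)
    Real.exp_injective.injOn g
  simpa [image_univ, Real.range_exp] using h

lemma memE_iff {φ : ℝ} {e : ℂ → ℂ} : MemE φ e ↔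
    MemHInf φ e ∧ ∀ δ : ℝ, |δ| < φ → Integrable fun x => e (Complex.exp (horiz δ x)) := by
  refine and_congr_right fun _ => forall₂_congr fun δ _ => ?_
  rw [integrableOn_Ioi_iff_exp]
  refine iff_of_eq (congrArg (fun f => Integrable f volume) (funext fun x => ?_))
  have : (Complex.exp x : ℂ) ≠ 0 := Complex.exp_ne_zero _
  rw [ray_exp, Complex.real_smul, Complex.ofReal_exp]
  field_simp

/-- Points whose arguments differ by an angle bounded away from `2πℤ` are far apart. -/
lemma one_sub_mul_sq_norm_add_le {u v : ℂ} {c : ℝ} (hc : Real.cos (v.im - u.im) ≤ c) :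
    (1 - c) * (‖Complex.exp v‖ + ‖Complex.exp u‖) ^ 2
      ≤ 2 * ‖Complex.exp v - Complex.exp u‖ ^ 2 := by
  have h1 : ‖Complex.exp v - Complex.exp u‖ ^ 2
      = Real.exp v.re ^ 2 + Real.exp u.re ^ 2
        - 2 * (Real.exp v.re * Real.exp u.re) * Real.cos (v.im - u.im) := by
    rw [Complex.sq_norm, Complex.normSq_apply, Complex.sub_re, Complex.sub_im, Complex.exp_re,
      Complex.exp_re, Complex.exp_im, Complex.exp_im, Real.cos_sub]
    linear_combination (Real.exp v.re) ^ 2 * Real.sin_sq_add_cos_sq v.im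
      + (Real.exp u.re) ^ 2 * Real.sin_sq_add_cos_sq u.im
  rw [h1, Complex.norm_exp, Complex.norm_exp]
  have h2 : 0 < Real.exp v.re * Real.exp u.re := by positivity
  have h3 : -1 ≤ c := (Real.neg_one_le_cos _).trans hc
  have h4 := mul_le_mul_of_nonneg_left hc h2.le
  nlinarith [mul_nonneg (by linarith : 0 ≤ 1 + c) (sq_nonneg (Real.exp v.re - Real.exp u.re))]

/-- The constant by which points separated by an angle of cosine at most `c` are kept apart. -/
def sepConst (c : ℝ) : ℝ := Real.sqrt (2 / (1 - c))

lemma sepConst_nonneg (c : ℝ) : 0 ≤ sepConst c := Real.sqrt_nonneg _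

lemma norm_exp_add_norm_exp_le {u v : ℂ} {c : ℝ} (hc1 : c < 1)
    (hc : Real.cos (v.im - u.im) ≤ c) :
    ‖Complex.exp v‖ + ‖Complex.exp u‖ ≤ sepConst c * ‖Complex.exp v - Complex.exp u‖ := by
  refine abs_le_of_sq_le_sq' ?_ (mul_nonneg (sepConst_nonneg c) (norm_nonneg _)) |>.2
  have h : 0 < 1 - c := by linarith
  rw [mul_pow, sepConst, Real.sq_sqrt (by positivity), div_mul_eq_mul_div, le_div_iff₀ h, mul_comm]
  exact one_sub_mul_sq_norm_add_le hc

lemma cos_le_cos_of_abs_mem {γ η : ℝ} (h0 : 0 ≤ η) (h1 : η ≤ |γ|) (h2 : |γ| ≤ 2 * Real.pi - η) :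
    Real.cos γ ≤ Real.cos η := by
  rw [← Real.cos_abs γ]
  rcases le_total |γ| Real.pi with h | h
  · exact Real.cos_le_cos_of_nonneg_of_le_pi h0 h h1
  · rw [← Real.cos_two_pi_sub |γ|]
    exact Real.cos_le_cos_of_nonneg_of_le_pi h0 (by linarith) (by linarith)

lemma cos_lt_one {η : ℝ} (h0 : 0 < η) (h1 : η ≤ Real.pi) : Real.cos η < 1 := by
  rw [← Real.cos_zero]
  exact Real.cos_lt_cos_of_nonneg_of_le_pi le_rfl h1 h0

lemma exp_sub_exp_ne_zero {u v : ℂ} {c : ℝ} (hc1 : c < 1)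
    (hc : Real.cos (v.im - u.im) ≤ c) : Complex.exp v - Complex.exp u ≠ 0 := by
  intro h
  have h1 := norm_exp_add_norm_exp_le hc1 hc
  rw [h, norm_zero, mul_zero] at h1
  have := norm_pos_iff.2 (Complex.exp_ne_zero v)
  linarith [norm_nonneg (Complex.exp u)]

lemma norm_exp_div_sub_le {u v : ℂ} {c : ℝ} (hc1 : c < 1)
    (hc : Real.cos (v.im - u.im) ≤ c) :
    ‖Complex.exp v / (Complex.exp v - Complex.exp u)‖ ≤ sepConst c := by
  have h0 := exp_sub_exp_ne_zero hc1 hc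
  rw [norm_div, div_le_iff₀ (norm_pos_iff.2 h0)]
  linarith [norm_exp_add_norm_exp_le hc1 hc, norm_nonneg (Complex.exp u)]

lemma norm_exp_div_sub_le' {u v : ℂ} {c : ℝ} (hc1 : c < 1)
    (hc : Real.cos (v.im - u.im) ≤ c) :
    ‖Complex.exp u / (Complex.exp v - Complex.exp u)‖ ≤ sepConst c := by
  have h0 := exp_sub_exp_ne_zero hc1 hc
  rw [norm_div, div_le_iff₀ (norm_pos_iff.2 h0)]
  linarith [norm_exp_add_norm_exp_le hc1 hc, norm_nonneg (Complex.exp v)]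

/-! ### Integrals over the boundary of a sector -/

section Boundary

variable {Y : Type*} [NormedAddCommGroup Y]

/-- Absolute integrability over the two boundary lines. -/
def BdryIntegrable (δ : ℝ) (g : ℂ → Y) : Prop :=
  Integrable (fun x => g (horiz (-δ) x)) ∧ Integrable fun x => g (horiz δ x)

lemma BdryIntegrable.congr {δ : ℝ} {g h : ℂ → Y} (hg : BdryIntegrable δ g)
    (hgh : ∀ v : ℂ, |v.im| = |δ| → g v = h v) : BdryIntegrable δ h := by
  have h1 : ∀ x, g (horiz (-δ) x) = h (horiz (-δ) x) := fun x => hgh _ (by simp)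
  have h2 : ∀ x, g (horiz δ x) = h (horiz δ x) := fun x => hgh _ (by simp)
  simpa only [BdryIntegrable, h1, h2] using hg

lemma BdryIntegrable.add {δ : ℝ} {g h : ℂ → Y} (hg : BdryIntegrable δ g)
    (hh : BdryIntegrable δ h) : BdryIntegrable δ fun v => g v + h v :=
  ⟨hg.1.add hh.1, hg.2.add hh.2⟩

lemma BdryIntegrable.sub {δ : ℝ} {g h : ℂ → Y} (hg : BdryIntegrable δ g)
    (hh : BdryIntegrable δ h) : BdryIntegrable δ fun v => g v - h v :=
  ⟨hg.1.sub hh.1, hg.2.sub hh.2⟩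

variable [NormedSpace ℂ Y]

/-- The integral over the positively oriented boundary of the sector of half-angle `δ`, in the
logarithmic coordinate `v = log z`; the boundary consists of the two lines at heights `∓ δ`. -/
def bdryIntegral (δ : ℝ) (g : ℂ → Y) : Y :=
  (∫ x, g (horiz (-δ) x)) - ∫ x, g (horiz δ x)

lemma bdryIntegral_congr {δ : ℝ} {g h : ℂ → Y} (hgh : ∀ v : ℂ, |v.im| = |δ| → g v = h v) :
    bdryIntegral δ g = bdryIntegral δ h := by
  have h1 : ∀ x, g (horiz (-δ) x) = h (horiz (-δ) x) := fun x => hgh _ (by simp)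
  have h2 : ∀ x, g (horiz δ x) = h (horiz δ x) := fun x => hgh _ (by simp)
  simp only [bdryIntegral, h1, h2]

lemma bdryIntegral_add {δ : ℝ} {g h : ℂ → Y} (hg : BdryIntegrable δ g) (hh : BdryIntegrable δ h) :
    bdryIntegral δ (fun v => g v + h v) = bdryIntegral δ g + bdryIntegral δ h := by
  simp only [bdryIntegral, integral_add hg.1 hh.1, integral_add hg.2 hh.2]
  abel

lemma bdryIntegral_sub {δ : ℝ} {g h : ℂ → Y} (hg : BdryIntegrable δ g) (hh : BdryIntegrable δ h) :
    bdryIntegral δ (fun v => g v - h v) = bdryIntegral δ g - bdryIntegral δ h := by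
  simp only [bdryIntegral, integral_sub hg.1 hh.1, integral_sub hg.2 hh.2]
  abel

lemma bdryIntegral_const_smul (δ : ℝ) (c : ℂ) (g : ℂ → Y) :
    bdryIntegral δ (fun v => c • g v) = c • bdryIntegral δ g := by
  simp only [bdryIntegral, integral_smul, smul_sub]

lemma BdryIntegrable.const_smul {δ : ℝ} {g : ℂ → Y} (hg : BdryIntegrable δ g) (c : ℂ) :
    BdryIntegrable δ fun v => c • g v :=
  ⟨hg.1.smul c, hg.2.smul c⟩

lemma bdryIntegral_clm_comp {Z : Type*} [NormedAddCommGroup Z] [NormedSpace ℂ Z]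
    [CompleteSpace Y] [CompleteSpace Z] {δ : ℝ} {g : ℂ → Y} (hg : BdryIntegrable δ g)
    (L : Y →L[ℂ] Z) : bdryIntegral δ (fun v => L (g v)) = L (bdryIntegral δ g) := by
  simp only [bdryIntegral, L.integral_comp_comm hg.1, L.integral_comp_comm hg.2, map_sub]

lemma BdryIntegrable.clm_comp {Z : Type*} [NormedAddCommGroup Z] [NormedSpace ℂ Z]
    {δ : ℝ} {g : ℂ → Y} (hg : BdryIntegrable δ g)
    (L : Y →L[ℂ] Z) : BdryIntegrable δ fun v => L (g v) :=
  ⟨L.integrable_comp hg.1, L.integrable_comp hg.2⟩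

lemma bdryIntegral_eq_zero {δ : ℝ} (hδ : 0 ≤ δ) {g : ℂ → Y} (hg : BdryIntegrable δ g)
    (hd : ∀ v : ℂ, |v.im| ≤ δ → DifferentiableAt ℂ g v) {C : ℝ}
    (hC : ∀ v : ℂ, |v.im| ≤ δ → ‖g v‖ ≤ C) : bdryIntegral δ g = 0 :=
  sub_eq_zero.2 (integral_horiz_eq (by linarith) (fun v hv => hd v (abs_le.2 hv))
    (fun v hv => hC v (abs_le.2 hv)) hg.1 hg.2)

lemma bdryIntegral_eq_of_le {δ₁ δ₂ : ℝ} (h0 : 0 ≤ δ₁) (h12 : δ₁ ≤ δ₂) {g : ℂ → Y}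
    (hg₁ : BdryIntegrable δ₁ g) (hg₂ : BdryIntegrable δ₂ g)
    (hd : ∀ v : ℂ, δ₁ ≤ |v.im| → |v.im| ≤ δ₂ → DifferentiableAt ℂ g v) {C : ℝ}
    (hC : ∀ v : ℂ, δ₁ ≤ |v.im| → |v.im| ≤ δ₂ → ‖g v‖ ≤ C) :
    bdryIntegral δ₁ g = bdryIntegral δ₂ g := by
  have h1 : ∀ v : ℂ, v.im ∈ Icc δ₁ δ₂ → δ₁ ≤ |v.im| ∧ |v.im| ≤ δ₂ := fun v hv => by
    rw [abs_of_nonneg (h0.trans hv.1)]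
    exact hv
  have h2 : ∀ v : ℂ, v.im ∈ Icc (-δ₂) (-δ₁) → δ₁ ≤ |v.im| ∧ |v.im| ≤ δ₂ := fun v hv => by
    rw [abs_of_nonpos (by linarith [hv.2])]
    exact ⟨by linarith [hv.2], by linarith [hv.1]⟩
  rw [bdryIntegral, bdryIntegral,
    integral_horiz_eq h12 (fun v hv => hd v (h1 v hv).1 (h1 v hv).2)
      (fun v hv => hC v (h1 v hv).1 (h1 v hv).2) hg₁.2 hg₂.2,
    integral_horiz_eq (neg_le_neg h12) (fun v hv => hd v (h2 v hv).1 (h2 v hv).2)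
      (fun v hv => hC v (h2 v hv).1 (h2 v hv).2) hg₂.1 hg₁.1]

/-- A bounded factor, continuous on the two lines, preserves integrability. -/
lemma BdryIntegrable.smul_bdd {δ : ℝ} {k : ℂ → ℂ} {g : ℂ → Y} (hk : BdryIntegrable δ k)
    (hc : ∀ v : ℂ, |v.im| = |δ| → ContinuousAt g v) {C : ℝ}
    (hC : ∀ v : ℂ, |v.im| = |δ| → ‖g v‖ ≤ C) : BdryIntegrable δ fun v => k v • g v := by
  have key : ∀ y : ℝ, |y| = |δ| → Integrable (fun x => k (horiz y x)) →
      Integrable fun x => k (horiz y x) • g (horiz y x) := by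
    intro y hy hi
    refine hi.smul_bdd C (Continuous.aestronglyMeasurable ?_)
      (Eventually.of_forall fun x => hC (horiz y x) (by simpa using hy))
    rw [continuous_iff_continuousAt]
    intro x
    exact ContinuousAt.comp (f := horiz y) (hc (horiz y x) (by simpa using hy))
      (continuous_horiz y).continuousAt
  exact ⟨key _ (by simp) hk.1, key _ rfl hk.2⟩

end Boundary

/-! ### The classes of scalar functions -/

lemma MemHInf.mono {φ ψ : ℝ} (h : ψ ≤ φ) {f : ℂ → ℂ} (hf : MemHInf φ f) : MemHInf ψ f :=
  ⟨hf.1.mono (sector_mono h), hf.2.imp fun _ hC z hz => hC z (sector_mono h hz)⟩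

lemma MemHInf.add {φ : ℝ} {f g : ℂ → ℂ} (hf : MemHInf φ f) (hg : MemHInf φ g) :
    MemHInf φ (f + g) := by
  obtain ⟨C, hC⟩ := hf.2
  obtain ⟨D, hD⟩ := hg.2
  exact ⟨hf.1.add hg.1, C + D, fun z hz => (norm_add_le _ _).trans (add_le_add (hC z hz) (hD z hz))⟩

lemma MemHInf.mul {φ : ℝ} {f g : ℂ → ℂ} (hf : MemHInf φ f) (hg : MemHInf φ g) :
    MemHInf φ (f * g) := by
  obtain ⟨C, hC⟩ := hf.2
  obtain ⟨D, hD⟩ := hg.2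
  refine ⟨hf.1.mul hg.1, C * D, fun z hz => ?_⟩
  rw [Pi.mul_apply, norm_mul]
  exact mul_le_mul (hC z hz) (hD z hz) (norm_nonneg _) ((norm_nonneg _).trans (hC z hz))

lemma memHInf_const (φ : ℝ) (c : ℂ) : MemHInf φ fun _ => c :=
  ⟨differentiableOn_const c, ‖c‖, fun _ _ => le_rfl⟩

lemma MemHInf.congr {φ : ℝ} {f g : ℂ → ℂ} (hf : MemHInf φ f) (h : ∀ z ∈ sector φ, g z = f z) :
    MemHInf φ g :=
  ⟨hf.1.congr h, hf.2.imp fun _ hC z hz => by rw [h z hz]; exact hC z hz⟩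

lemma MemHInf.differentiableAt_comp_exp {φ : ℝ} (hφ : φ < Real.pi) {f : ℂ → ℂ} (hf : MemHInf φ f)
    {v : ℂ} (hv : |v.im| < φ) : DifferentiableAt ℂ (fun v => f (Complex.exp v)) v :=
  (hf.1.differentiableAt ((isOpen_sector φ).mem_nhds (exp_mem_sector hv hφ))).comp v
    Complex.differentiable_exp.differentiableAt

lemma MemHInf.continuous_comp_horiz {φ : ℝ} (hφ : φ < Real.pi) {f : ℂ → ℂ} (hf : MemHInf φ f)
    {δ : ℝ} (hδ : |δ| < φ) : Continuous fun x => f (Complex.exp (horiz δ x)) := by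
  rw [continuous_iff_continuousAt]
  intro x
  have := (hf.differentiableAt_comp_exp hφ (v := horiz δ x) (by simpa using hδ)).continuousAt
  exact ContinuousAt.comp (f := horiz δ) this (continuous_horiz δ).continuousAt

lemma MemE.mono {φ ψ : ℝ} (h : ψ ≤ φ) {e : ℂ → ℂ} (he : MemE φ e) : MemE ψ e :=
  ⟨he.1.mono h, fun δ hδ => he.2 δ (hδ.trans_le h)⟩

lemma MemE.add {φ : ℝ} {e f : ℂ → ℂ} (he : MemE φ e) (hf : MemE φ f) : MemE φ (e + f) := by
  rw [memE_iff] at *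
  exact ⟨he.1.add hf.1, fun δ hδ => (he.2 δ hδ).add (hf.2 δ hδ)⟩

lemma MemE.mul {φ : ℝ} (hφ : φ < Real.pi) {e f : ℂ → ℂ} (he : MemE φ e) (hf : MemHInf φ f) :
    MemE φ (e * f) := by
  rw [memE_iff] at *
  obtain ⟨C, hC⟩ := hf.2
  refine ⟨he.1.mul hf, fun δ hδ => (he.2 δ hδ).mul_bdd
    (hf.continuous_comp_horiz hφ hδ).aestronglyMeasurable
    (Eventually.of_forall fun x => hC _ (exp_mem_sector (by simpa using hδ) hφ))⟩

lemma MemE.const_mul {φ : ℝ} {e : ℂ → ℂ} (he : MemE φ e) (c : ℂ) : MemE φ fun z => c * e z := by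
  rw [memE_iff] at *
  exact ⟨(memHInf_const φ c).mul he.1, fun δ hδ => (he.2 δ hδ).const_mul c⟩

lemma memE_zero (φ : ℝ) : MemE φ 0 := by
  rw [memE_iff]
  exact ⟨memHInf_const φ 0, fun δ _ => by simp⟩

lemma MemE.congr {φ : ℝ} (hφ : φ < Real.pi) {e f : ℂ → ℂ} (he : MemE φ e)
    (h : ∀ z ∈ sector φ, f z = e z) : MemE φ f := by
  rw [memE_iff] at *
  refine ⟨he.1.congr h, fun δ hδ => ?_⟩
  have : ∀ x, f (Complex.exp (horiz δ x)) = e (Complex.exp (horiz δ x)) := fun x =>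
    h _ (exp_mem_sector (by simpa using hδ) hφ)
  simpa only [this] using he.2 δ hδ

lemma MemE.bdryIntegrable {φ : ℝ} {e : ℂ → ℂ} (he : MemE φ e) {δ : ℝ} (hδ : |δ| < φ) :
    BdryIntegrable δ fun v => e (Complex.exp v) :=
  ⟨(memE_iff.1 he).2 (-δ) (by rwa [abs_neg]), (memE_iff.1 he).2 δ hδ⟩

/-! ### Rational functions on sectors -/

lemma cos_sub_le_of_abs_le {u v : ℂ} {δ : ℝ} (hv : |v.im| ≤ δ) (hu : δ ≤ |u.im|)
    (hu' : |u.im| ≤ Real.pi) : Real.cos (v.im - u.im) ≤ Real.cos (|u.im| - δ) := by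
  refine cos_le_cos_of_abs_mem (by linarith) ?_ ?_
  · have := abs_sub_abs_le_abs_sub u.im v.im
    rw [abs_sub_comm] at this
    linarith
  · have := abs_sub v.im u.im
    linarith

lemma cos_abs_sub_lt_one {u : ℂ} {δ : ℝ} (hδ : 0 ≤ δ) (hu : δ < |u.im|)
    (hu' : |u.im| ≤ Real.pi) : Real.cos (|u.im| - δ) < 1 :=
  cos_lt_one (by linarith) (by linarith)

lemma exp_horiz_pi (x : ℝ) : Complex.exp (horiz Real.pi x) = -(Real.exp x : ℂ) := by
  rw [horiz, Complex.exp_add, Complex.exp_pi_mul_I, Complex.ofReal_exp]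
  ring

lemma exists_eq_exp_of_mem_sector {φ : ℝ} {z : ℂ} (hz : z ∈ sector φ) :
    ∃ v : ℂ, |v.im| < φ ∧ Complex.exp v = z :=
  ⟨Complex.log z, by rw [Complex.log_im]; exact hz.2, Complex.exp_log hz.1⟩

/-- For every `t > 0` the function `t / (t + z)` is bounded on a sector, with a bound that does not
depend on `t`. -/
lemma exists_norm_div_add_le {φ : ℝ} (hφ : φ < Real.pi) :
    ∃ K : ℝ, ∀ t : ℝ, 0 < t → ∀ z ∈ sector φ, (t : ℂ) + z ≠ 0 ∧ ‖(t : ℂ) / (t + z)‖ ≤ K := by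
  refine ⟨sepConst (Real.cos (Real.pi - φ)), fun t ht z hz => ?_⟩
  obtain ⟨v, hv, rfl⟩ := exists_eq_exp_of_mem_sector hz
  have hφ0 : 0 ≤ φ := (abs_nonneg _).trans hv.le
  have hpi : |(horiz Real.pi (Real.log t)).im| = Real.pi := by
    rw [horiz_im, abs_of_pos Real.pi_pos]
  have h1 := cos_sub_le_of_abs_le (u := horiz Real.pi (Real.log t)) hv.le
    (by rw [hpi]; exact hφ.le) hpi.le
  have h2 := cos_abs_sub_lt_one (u := horiz Real.pi (Real.log t)) hφ0 (by rwa [hpi]) hpi.le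
  rw [hpi] at h1 h2
  have h3 := exp_sub_exp_ne_zero h2 h1
  have h4 := norm_exp_div_sub_le' h2 h1
  rw [exp_horiz_pi, Real.exp_log ht, sub_neg_eq_add, add_comm] at h3 h4
  rw [neg_div, norm_neg] at h4
  exact ⟨h3, h4⟩

lemma one_add_ne_zero_of_mem_sector {φ : ℝ} (hφ : φ < Real.pi) {z : ℂ} (hz : z ∈ sector φ) :
    1 + z ≠ 0 := by
  obtain ⟨K, hK⟩ := exists_norm_div_add_le hφ
  simpa using (hK 1 one_pos z hz).1

lemma memHInf_div_add {φ : ℝ} (hφ : φ < Real.pi) {t : ℝ} (ht : 0 < t) :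
    MemHInf φ fun z => (t : ℂ) / (t + z) := by
  obtain ⟨K, hK⟩ := exists_norm_div_add_le hφ
  refine ⟨fun z hz => DifferentiableAt.differentiableWithinAt ?_, K, fun z hz => (hK t ht z hz).2⟩
  exact (differentiableAt_const _).div (by fun_prop) (hK t ht z hz).1

lemma memHInf_inv_one_add {φ : ℝ} (hφ : φ < Real.pi) : MemHInf φ fun z => (1 + z)⁻¹ := by
  simpa using memHInf_div_add hφ one_pos

lemma integrable_exp_neg_abs : Integrable fun x : ℝ => Real.exp (-|x|) := by
  rw [← integrableOn_univ, ← Iic_union_Ioi (a := (0 : ℝ))]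
  refine IntegrableOn.union ?_ ?_
  · refine (integrableOn_exp_Iic 0).congr_fun (fun x hx => ?_) measurableSet_Iic
    simp [abs_of_nonpos (mem_Iic.1 hx)]
  · refine (integrableOn_exp_neg_Ioi 0).congr_fun (fun x hx => ?_) measurableSet_Ioi
    simp [abs_of_pos (mem_Ioi.1 hx)]

lemma exp_div_mul_le {r s : ℝ} (hr : 0 < r) (hs : 0 < s) (x : ℝ) :
    Real.exp x / ((Real.exp x + r) * (Real.exp x + s)) ≤ (1 + (r * s)⁻¹) * Real.exp (-|x|) := by
  have hx := Real.exp_pos x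
  rw [div_le_iff₀ (by positivity)]
  rcases le_total 0 x with h | h
  · rw [abs_of_nonneg h, Real.exp_neg]
    have h1 : Real.exp x * Real.exp x ≤ (Real.exp x + r) * (Real.exp x + s) := by gcongr <;> linarith
    have h2 : 1 ≤ 1 + (r * s)⁻¹ := le_add_of_nonneg_right (by positivity)
    calc Real.exp x = 1 * (Real.exp x)⁻¹ * (Real.exp x * Real.exp x) := by field_simp
      _ ≤ _ := by gcongr
  · rw [abs_of_nonpos h, neg_neg]
    have h1 : r * s ≤ (Real.exp x + r) * (Real.exp x + s) := by gcongr <;> linarith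
    calc Real.exp x = (r * s)⁻¹ * Real.exp x * (r * s) := by field_simp
      _ ≤ _ := by gcongr; linarith

/-- The function `z / (1 + z)²`, the basic element of `𝓔`. -/
def qFun (z : ℂ) : ℂ := z * (1 + z)⁻¹ * (1 + z)⁻¹

lemma memE_qFun {φ : ℝ} (hφ : φ < Real.pi) : MemE φ qFun := by
  have h1 : ∀ z ∈ sector φ, qFun z = (1 + -1 * (1 + z)⁻¹) * (1 + z)⁻¹ := fun z hz => by
    have := one_add_ne_zero_of_mem_sector hφ hz
    rw [qFun]
    field_simp
    ring
  have h2 : MemHInf φ qFun := by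
    refine MemHInf.congr ?_ h1
    exact ((memHInf_const φ 1).add ((memHInf_const φ (-1)).mul (memHInf_inv_one_add hφ))).mul
      (memHInf_inv_one_add hφ)
  refine memE_iff.2 ⟨h2, fun δ hδ => ?_⟩
  have hφ0 : 0 < φ := (abs_nonneg _).trans_lt hδ
  set c := Real.cos (Real.pi - |δ|) with hc
  have hpi : |(horiz Real.pi 0).im| = Real.pi := by
    rw [horiz_im, abs_of_pos Real.pi_pos]
  refine Integrable.mono' (integrable_exp_neg_abs.const_mul (sepConst c ^ 2 * (1 + (1 * 1)⁻¹)))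
    (h2.continuous_comp_horiz hφ hδ).aestronglyMeasurable (Eventually.of_forall fun x => ?_)
  have h3 := cos_sub_le_of_abs_le (u := horiz Real.pi 0) (v := horiz δ x) (δ := |δ|) (by simp)
    (by rw [hpi]; exact (hδ.trans hφ).le) hpi.le
  have h4 := cos_abs_sub_lt_one (u := horiz Real.pi 0) (abs_nonneg δ)
    (by rw [hpi]; exact hδ.trans hφ) hpi.le
  rw [hpi] at h3 h4
  have h5 := norm_exp_add_norm_exp_le h4 h3
  have h6 := exp_sub_exp_ne_zero h4 h3
  have h7 : Complex.exp (horiz δ x) - Complex.exp (horiz Real.pi 0)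
      = 1 + Complex.exp (horiz δ x) := by
    rw [exp_horiz_pi, Real.exp_zero, Complex.ofReal_one]; ring
  rw [h7, Complex.norm_exp, Complex.norm_exp, horiz_re, horiz_re, Real.exp_zero] at h5
  rw [h7] at h6
  have h8 : ‖(1 + Complex.exp (horiz δ x))⁻¹‖ ≤ sepConst c * (Real.exp x + 1)⁻¹ := by
    rw [norm_inv, ← div_eq_mul_inv, le_div_iff₀ (by positivity),
      inv_mul_le_iff₀ (norm_pos_iff.2 h6), mul_comm]
    exact h5
  calc ‖qFun (Complex.exp (horiz δ x))‖
      = Real.exp x * ‖(1 + Complex.exp (horiz δ x))⁻¹‖ * ‖(1 + Complex.exp (horiz δ x))⁻¹‖ := by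
        rw [qFun, norm_mul, norm_mul, Complex.norm_exp, horiz_re]
    _ ≤ Real.exp x * (sepConst c * (Real.exp x + 1)⁻¹) * (sepConst c * (Real.exp x + 1)⁻¹) := by
        have := sepConst_nonneg c
        gcongr
    _ = sepConst c ^ 2 * (Real.exp x / ((Real.exp x + 1) * (Real.exp x + 1))) := by
        field_simp
    _ ≤ sepConst c ^ 2 * ((1 + (1 * 1)⁻¹) * Real.exp (-|x|)) := by
        gcongr
        exact exp_div_mul_le one_pos one_pos x
    _ = _ := by ring

/-! ### The Cauchy formula on a sector -/

lemma exp_add_exp_mem_slitPlane {w : ℂ} (hw : |w.im| < Real.pi) (x : ℝ) :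
    (Real.exp x : ℂ) + Complex.exp w ∈ Complex.slitPlane := by
  rw [Complex.mem_slitPlane_iff, Complex.add_re, Complex.add_im, Complex.ofReal_re,
    Complex.ofReal_im, Complex.exp_re, Complex.exp_im, zero_add]
  by_cases h : w.im = 0
  · left
    rw [h, Real.cos_zero]
    positivity
  · right
    refine mul_ne_zero (Real.exp_ne_zero _) fun h0 => h ?_
    exact (Real.sin_eq_zero_iff_of_lt_of_lt (abs_lt.1 hw).1 (abs_lt.1 hw).2).1 h0

lemma norm_exp_add_exp_ge {w : ℂ} (hw : |w.im| < Real.pi) :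
    ∃ K > 0, ∀ x : ℝ, Real.exp x + Real.exp w.re ≤ K * ‖(Real.exp x : ℂ) + Complex.exp w‖ := by
  have h1 : |(horiz Real.pi 0).im| = Real.pi := by rw [horiz_im, abs_of_pos Real.pi_pos]
  have hw0 := abs_nonneg w.im
  have hlt := cos_abs_sub_lt_one (u := horiz Real.pi 0) (δ := |w.im|) hw0 (by rwa [h1]) h1.le
  rw [h1] at hlt
  have hK := sepConst_nonneg (Real.cos (Real.pi - |w.im|))
  refine ⟨sepConst (Real.cos (Real.pi - |w.im|)) + 1, by linarith, fun x => ?_⟩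
  have h2 : Complex.exp (w - x) - Complex.exp (horiz Real.pi 0)
      = (Real.exp x : ℂ)⁻¹ * ((Real.exp x : ℂ) + Complex.exp w) := by
    rw [exp_horiz_pi, Complex.exp_sub, Real.exp_zero, Complex.ofReal_exp]
    have := Complex.exp_ne_zero (x : ℂ)
    field_simp
    push_cast
    ring
  have h3 := cos_sub_le_of_abs_le (u := horiz Real.pi 0) (v := w - x) (δ := |w.im|) (by simp)
    (by rw [h1]; exact hw.le) h1.le
  rw [h1] at h3
  have h4 := norm_exp_add_norm_exp_le hlt h3
  have hx := Real.exp_pos x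
  rw [h2, norm_mul, norm_inv, Complex.norm_real, Real.norm_of_nonneg hx.le, Complex.norm_exp,
    Complex.norm_exp, Complex.sub_re, Complex.ofReal_re, horiz_re, Real.exp_zero, Real.exp_sub]
    at h4
  have h5 : Real.exp x + Real.exp w.re = Real.exp x * (Real.exp w.re / Real.exp x + 1) := by
    field_simp
    ring
  rw [h5]
  calc _ ≤ Real.exp x * (sepConst (Real.cos (Real.pi - |w.im|)) *
        ((Real.exp x)⁻¹ * ‖(Real.exp x : ℂ) + Complex.exp w‖)) := by gcongr
    _ = sepConst (Real.cos (Real.pi - |w.im|)) * ‖(Real.exp x : ℂ) + Complex.exp w‖ := by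
      field_simp
    _ ≤ _ := by gcongr; linarith

lemma integrable_exp_div_sub {w₁ w₂ : ℂ} (h₁ : |w₁.im| < Real.pi) (h₂ : |w₂.im| < Real.pi) :
    Integrable fun x : ℝ => (Real.exp x : ℂ) / (Real.exp x + Complex.exp w₁)
      - (Real.exp x : ℂ) / (Real.exp x + Complex.exp w₂) := by
  obtain ⟨K₁, hK₁, hb₁⟩ := norm_exp_add_exp_ge h₁
  obtain ⟨K₂, hK₂, hb₂⟩ := norm_exp_add_exp_ge h₂
  have hne₁ := fun x => Complex.slitPlane_ne_zero (exp_add_exp_mem_slitPlane h₁ x)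
  have hne₂ := fun x => Complex.slitPlane_ne_zero (exp_add_exp_mem_slitPlane h₂ x)
  have hcont : Continuous fun x : ℝ => (Real.exp x : ℂ) :=
    Complex.continuous_ofReal.comp Real.continuous_exp
  refine Integrable.mono' (integrable_exp_neg_abs.const_mul (‖Complex.exp w₂ - Complex.exp w₁‖ *
    (K₁ * K₂ * (1 + (Real.exp w₁.re * Real.exp w₂.re)⁻¹))))
    (Continuous.aestronglyMeasurable ?_) (Eventually.of_forall fun x => ?_)
  · exact (hcont.div (hcont.add continuous_const) hne₁).sub
      (hcont.div (hcont.add continuous_const) hne₂)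
  · have hx := Real.exp_pos x
    have e : (Real.exp x : ℂ) / (Real.exp x + Complex.exp w₁)
        - (Real.exp x : ℂ) / (Real.exp x + Complex.exp w₂)
        = (Complex.exp w₂ - Complex.exp w₁) * (Real.exp x : ℂ) *
          ((Real.exp x + Complex.exp w₁)⁻¹ * (Real.exp x + Complex.exp w₂)⁻¹) := by
      have a1 := hne₁ x
      have a2 := hne₂ x
      field_simp
      ring
    have b : ∀ {w : ℂ} {K : ℝ}, (Real.exp x : ℂ) + Complex.exp w ≠ 0 →
        Real.exp x + Real.exp w.re ≤ K * ‖(Real.exp x : ℂ) + Complex.exp w‖ →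
        ‖((Real.exp x : ℂ) + Complex.exp w)⁻¹‖ ≤ K * (Real.exp x + Real.exp w.re)⁻¹ := by
      intro w K h0 h
      rw [norm_inv, ← div_eq_mul_inv, le_div_iff₀ (by positivity),
        inv_mul_le_iff₀ (norm_pos_iff.2 h0), mul_comm]
      exact h
    rw [e, norm_mul, norm_mul, norm_mul, Complex.norm_real, Real.norm_of_nonneg hx.le]
    calc _ ≤ ‖Complex.exp w₂ - Complex.exp w₁‖ * Real.exp x *
          ((K₁ * (Real.exp x + Real.exp w₁.re)⁻¹) * (K₂ * (Real.exp x + Real.exp w₂.re)⁻¹)) := by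
          gcongr
          · exact b (hne₁ x) (hb₁ x)
          · exact b (hne₂ x) (hb₂ x)
      _ = ‖Complex.exp w₂ - Complex.exp w₁‖ * (K₁ * K₂ * (Real.exp x /
          ((Real.exp x + Real.exp w₁.re) * (Real.exp x + Real.exp w₂.re)))) := by
          field_simp
      _ ≤ ‖Complex.exp w₂ - Complex.exp w₁‖ * (K₁ * K₂ *
          ((1 + (Real.exp w₁.re * Real.exp w₂.re)⁻¹) * Real.exp (-|x|))) := by
          gcongr
          exact exp_div_mul_le (Real.exp_pos _) (Real.exp_pos _) x
      _ = _ := by ring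

/-- An explicit integral along a ray, from the primitive
`log (eˣ + exp w₁) - log (eˣ + exp w₂)`. -/
lemma integral_exp_div_sub {w₁ w₂ : ℂ} (h₁ : |w₁.im| < Real.pi) (h₂ : |w₂.im| < Real.pi) :
    ∫ x : ℝ, ((Real.exp x : ℂ) / (Real.exp x + Complex.exp w₁)
      - (Real.exp x : ℂ) / (Real.exp x + Complex.exp w₂)) = w₂ - w₁ := by
  have hder : ∀ {w : ℂ}, |w.im| < Real.pi → ∀ x : ℝ,
      HasDerivAt (fun x : ℝ => Complex.log ((Real.exp x : ℂ) + Complex.exp w))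
        ((Real.exp x : ℂ) / (Real.exp x + Complex.exp w)) x := fun hw x =>
    (((Real.hasDerivAt_exp x).ofReal_comp).add_const _).clog_real (exp_add_exp_mem_slitPlane hw x)
  have hbot : ∀ {w : ℂ}, |w.im| < Real.pi → Tendsto (fun x : ℝ =>
      Complex.log ((Real.exp x : ℂ) + Complex.exp w)) atBot (𝓝 w) := by
    intro w hw
    have h1 : Tendsto (fun x : ℝ => (Real.exp x : ℂ) + Complex.exp w) atBot
        (𝓝 (((0 : ℝ) : ℂ) + Complex.exp w)) :=
      ((Complex.continuous_ofReal.tendsto 0).comp Real.tendsto_exp_atBot).add_const _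
    have h2 : Complex.exp w ∈ Complex.slitPlane := by
      rw [Complex.mem_slitPlane_iff_arg, arg_exp hw]
      exact ⟨(lt_of_abs_lt hw).ne, Complex.exp_ne_zero w⟩
    rw [Complex.ofReal_zero, zero_add] at h1
    have h3 := (continuousAt_clog h2).tendsto.comp h1
    rwa [Complex.log_exp (abs_lt.1 hw).1 (abs_lt.1 hw).2.le] at h3
  have htop : ∀ w : ℂ, Tendsto (fun x : ℝ =>
      Complex.log (1 + (Real.exp (-x) : ℂ) * Complex.exp w)) atTop (𝓝 0) := by
    intro w
    have h1 : Tendsto (fun x : ℝ => 1 + (Real.exp (-x) : ℂ) * Complex.exp w) atTop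
        (𝓝 (1 + ((0 : ℝ) : ℂ) * Complex.exp w)) :=
      (((Complex.continuous_ofReal.tendsto 0).comp
        (Real.tendsto_exp_atBot.comp tendsto_neg_atTop_atBot)).mul_const _).const_add _
    rw [Complex.ofReal_zero, zero_mul, add_zero] at h1
    simpa [Function.comp_def] using (continuousAt_clog Complex.one_mem_slitPlane).tendsto.comp h1
  have hlog : ∀ {w : ℂ}, |w.im| < Real.pi → ∀ x : ℝ,
      Complex.log ((Real.exp x : ℂ) + Complex.exp w)
        = x + Complex.log (1 + (Real.exp (-x) : ℂ) * Complex.exp w) := by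
    intro w hw x
    have h1 : (Real.exp x : ℂ) + Complex.exp w
        = (Real.exp x : ℂ) * (1 + (Real.exp (-x) : ℂ) * Complex.exp w) := by
      rw [mul_add, ← mul_assoc, ← Complex.ofReal_mul, ← Real.exp_add]
      simp
    have h2 : 1 + (Real.exp (-x) : ℂ) * Complex.exp w ≠ 0 := by
      intro h
      rw [h, mul_zero] at h1
      exact Complex.slitPlane_ne_zero (exp_add_exp_mem_slitPlane hw x) h1
    rw [h1, Complex.log_ofReal_mul (Real.exp_pos x) h2, Real.log_exp]
  rw [integral_of_hasDerivAt_of_tendsto (fun x => (hder h₁ x).sub (hder h₂ x))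
    (integrable_exp_div_sub h₁ h₂) ((hbot h₁).sub (hbot h₂)) (n := 0)]
  · ring
  · have := (htop w₁).sub (htop w₂)
    rw [sub_zero] at this
    refine this.congr fun x => ?_
    simp only [Pi.sub_apply]
    rw [hlog h₁, hlog h₂]
    ring

/-- The kernel difference whose boundary integral is the winding number of the boundary of the
sector around `exp u` (the point `-1` lies outside). -/
lemma bdryIntegral_kernel {u : ℂ} {δ : ℝ} (hu : |u.im| < δ) (hδ : δ < Real.pi) :
    BdryIntegrable δ (fun v => Complex.exp v / (Complex.exp v - Complex.exp u)
      - Complex.exp v / (Complex.exp v + 1)) ∧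
    bdryIntegral δ (fun v => Complex.exp v / (Complex.exp v - Complex.exp u)
      - Complex.exp v / (Complex.exp v + 1)) = 2 * Real.pi * Complex.I := by
  have hu' := abs_lt.1 hu
  have key : ∀ (y : ℝ) (w₁ w₂ : ℂ), Complex.exp (w₁ + y * Complex.I) = -Complex.exp u →
      Complex.exp (w₂ + y * Complex.I) = 1 →
      (fun x => Complex.exp (horiz y x) / (Complex.exp (horiz y x) - Complex.exp u)
        - Complex.exp (horiz y x) / (Complex.exp (horiz y x) + 1)) =
      fun x : ℝ => (Real.exp x : ℂ) / (Real.exp x + Complex.exp w₁)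
        - (Real.exp x : ℂ) / (Real.exp x + Complex.exp w₂) := by
    intro y w₁ w₂ h1 h2
    funext x
    have h0 := Complex.exp_ne_zero (y * Complex.I)
    rw [Complex.exp_add] at h1 h2
    rw [horiz, Complex.exp_add, ← h2, sub_eq_add_neg _ (Complex.exp u), ← h1, ← add_mul, ← add_mul,
      mul_div_mul_right _ _ h0, mul_div_mul_right _ _ h0, Complex.ofReal_exp]
  have hpi : Complex.exp (-(Real.pi * Complex.I)) = -1 := by
    rw [Complex.exp_neg, Complex.exp_pi_mul_I]; norm_num
  have e1 := key (-δ) (u + δ * Complex.I - Real.pi * Complex.I) (δ * Complex.I)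
    (by
      rw [show u + δ * Complex.I - Real.pi * Complex.I + ((-δ : ℝ) : ℂ) * Complex.I
        = u + -(Real.pi * Complex.I) by push_cast; ring, Complex.exp_add, hpi]
      ring)
    (by rw [show (δ * Complex.I + ((-δ : ℝ) : ℂ) * Complex.I) = 0 by push_cast; ring,
      Complex.exp_zero])
  have e2 := key δ (u - δ * Complex.I + Real.pi * Complex.I) (-(δ * Complex.I))
    (by
      rw [show u - δ * Complex.I + Real.pi * Complex.I + (δ : ℂ) * Complex.I
        = u + Real.pi * Complex.I by ring, Complex.exp_add, Complex.exp_pi_mul_I]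
      ring)
    (by rw [show (-(δ * Complex.I) + (δ : ℂ) * Complex.I) = 0 by ring, Complex.exp_zero])
  have hδ0 : 0 < δ := (abs_nonneg _).trans_lt hu
  have a1 : |(u + δ * Complex.I - Real.pi * Complex.I).im| < Real.pi := by
    simp [abs_lt]; constructor <;> linarith
  have a2 : |(δ * Complex.I).im| < Real.pi := by
    simp [abs_lt]; constructor <;> linarith
  have a3 : |(u - δ * Complex.I + Real.pi * Complex.I).im| < Real.pi := by
    simp [abs_lt]; constructor <;> linarith
  have a4 : |(-(δ * Complex.I)).im| < Real.pi := by
    simp [abs_lt]; constructor <;> linarith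
  constructor
  · rw [BdryIntegrable, e1, e2]
    exact ⟨integrable_exp_div_sub a1 a2, integrable_exp_div_sub a3 a4⟩
  · rw [bdryIntegral, e1, e2, integral_exp_div_sub a1 a2, integral_exp_div_sub a3 a4]
    ring

lemma differentiableAt_exp_div_sub {u v : ℂ} (h : Complex.exp v - Complex.exp u ≠ 0) :
    DifferentiableAt ℂ (fun v => Complex.exp v / (Complex.exp v - Complex.exp u)) v :=
  Complex.differentiable_exp.differentiableAt.div
    (Complex.differentiable_exp.differentiableAt.sub_const _) h

lemma cos_sub_le_of_lt_bdry {u v : ℂ} {δ : ℝ} (hδ0 : 0 ≤ δ) (hδπ : δ < Real.pi)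
    (hu : |u.im| < δ) (hv : |v.im| = |δ|) :
    Real.cos (v.im - u.im) ≤ Real.cos (δ - |u.im|) := by
  rw [abs_of_nonneg hδ0] at hv
  rw [← neg_sub, Real.cos_neg]
  have := cos_sub_le_of_abs_le (u := v) (v := u) (δ := |u.im|) le_rfl
    (by rw [hv]; exact hu.le) (by rw [hv]; exact hδπ.le)
  rwa [hv] at this

lemma MemE.bdryIntegrable_cauchy {φ : ℝ} {f : ℂ → ℂ} (hf : MemE φ f) {u : ℂ} {δ : ℝ}
    (hu : |u.im| < δ) (hδφ : δ < φ) (hφ : φ < Real.pi) :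
    BdryIntegrable δ fun v =>
      f (Complex.exp v) * (Complex.exp v / (Complex.exp v - Complex.exp u)) := by
  have hδ0 : 0 < δ := (abs_nonneg _).trans_lt hu
  have hc1 : Real.cos (δ - |u.im|) < 1 :=
    cos_lt_one (by linarith) (by linarith [abs_nonneg u.im])
  exact (hf.bdryIntegrable (by rwa [abs_of_pos hδ0])).smul_bdd
    (g := fun v => Complex.exp v / (Complex.exp v - Complex.exp u))
    (fun v hv => (differentiableAt_exp_div_sub (exp_sub_exp_ne_zero hc1
      (cos_sub_le_of_lt_bdry hδ0.le (hδφ.trans hφ) hu hv))).continuousAt)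
    (fun v hv => norm_exp_div_sub_le hc1 (cos_sub_le_of_lt_bdry hδ0.le (hδφ.trans hφ) hu hv))

/-- The Cauchy integral formula on a sector for elements of `𝓔`. -/
lemma MemE.cauchy_formula {φ : ℝ} {f : ℂ → ℂ} (hf : MemE φ f) {u : ℂ} {δ : ℝ}
    (hu : |u.im| < δ) (hδφ : δ < φ) (hφ : φ < Real.pi) :
    bdryIntegral δ (fun v =>
      f (Complex.exp v) * (Complex.exp v / (Complex.exp v - Complex.exp u)))
      = 2 * Real.pi * Complex.I * f (Complex.exp u) := by
  have hδ0 : 0 < δ := (abs_nonneg _).trans_lt hu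
  set z₀ := Complex.exp u with hz₀
  have hz₀mem : z₀ ∈ sector φ := exp_mem_sector (hu.trans hδφ) hφ
  -- The pole at `z₀` is removed by subtracting a multiple of the explicit kernel.
  set N : ℂ → ℂ := fun z => f z - f z₀ * (z₀ + 1) * (1 + z)⁻¹ with hN
  have hNd : MemHInf φ N := by
    have h := hf.1.add ((memHInf_const φ (-(f z₀ * (z₀ + 1)))).mul (memHInf_inv_one_add hφ))
    refine h.congr fun z _ => ?_
    simp [hN, sub_eq_add_neg]
  have hNz₀ : N z₀ = 0 := by
    have := one_add_ne_zero_of_mem_sector hφ hz₀mem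
    simp only [hN]
    rw [add_comm z₀, mul_inv_cancel_right₀ this, sub_self]
  have hopen := (isOpen_sector φ).mem_nhds hz₀mem
  have hds : DifferentiableOn ℂ (dslope N z₀) (sector φ) :=
    (Complex.differentiableOn_dslope hopen).2 hNd.1
  set h : ℂ → ℂ := fun v => Complex.exp v * dslope N z₀ (Complex.exp v) with hh
  have hhd : ∀ v : ℂ, |v.im| ≤ δ → DifferentiableAt ℂ h v := fun v hv =>
    Complex.differentiable_exp.differentiableAt.mul
      ((hds.differentiableAt ((isOpen_sector φ).mem_nhds
        (exp_mem_sector (hv.trans_lt hδφ) hφ))).comp v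
          Complex.differentiable_exp.differentiableAt)
  have hval : ∀ z : ℂ, z ≠ z₀ → z * dslope N z₀ z = z / (z - z₀) * N z := by
    intro z hz
    rw [dslope_of_ne _ hz, slope_def_field, hNz₀]
    ring
  have hb : ∃ C, ∀ v : ℂ, |v.im| ≤ δ → ‖h v‖ ≤ C := by
    obtain ⟨r, hr, hball⟩ := Metric.nhds_basis_closedBall.mem_iff.1 hopen
    obtain ⟨M, hM⟩ := (isCompact_closedBall z₀ r).exists_bound_of_continuousOn
      (hds.continuousOn.mono hball)
    obtain ⟨D, hD⟩ := hNd.2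
    refine ⟨max ((‖z₀‖ + r) * M) ((1 + ‖z₀‖ / r) * D), fun v hv => ?_⟩
    have hmem := exp_mem_sector (hv.trans_lt hδφ) hφ
    set z := Complex.exp v with hz
    rcases le_or_gt ‖z - z₀‖ r with h1 | h1
    · refine le_max_of_le_left ?_
      simp only [hh]
      rw [norm_mul]
      have h2 : ‖z‖ ≤ ‖z₀‖ + r := by
        calc ‖z‖ = ‖z₀ + (z - z₀)‖ := by rw [add_sub_cancel]
          _ ≤ _ := (norm_add_le _ _).trans (by gcongr)
      exact mul_le_mul h2 (hM z (by rwa [mem_closedBall_iff_norm])) (norm_nonneg _) (by positivity)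
    · refine le_max_of_le_right ?_
      have hne : z ≠ z₀ := by
        rintro h3
        rw [h3, sub_self, norm_zero] at h1
        exact absurd h1 (not_lt.2 hr.le)
      simp only [hh]
      rw [hval z hne, norm_mul]
      refine mul_le_mul ?_ (hD z hmem) (norm_nonneg _) (by positivity)
      have h3 : z / (z - z₀) = 1 + z₀ / (z - z₀) := by
        have := sub_ne_zero.2 hne
        field_simp
        ring
      rw [h3]
      refine (norm_add_le _ _).trans ?_
      rw [norm_one, norm_div]
      gcongr
  obtain ⟨C, hC⟩ := hb
  obtain ⟨hk1, hk2⟩ := bdryIntegral_kernel hu (hδφ.trans hφ)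
  have hint := hf.bdryIntegrable_cauchy hu hδφ hφ
  have heq : ∀ v : ℂ, |v.im| = |δ| →
      f (Complex.exp v) * (Complex.exp v / (Complex.exp v - Complex.exp u))
        - f z₀ • (Complex.exp v / (Complex.exp v - Complex.exp u)
          - Complex.exp v / (Complex.exp v + 1)) = h v := by
    intro v hv
    have hc1 : Real.cos (δ - |u.im|) < 1 :=
      cos_lt_one (by linarith) (by linarith [abs_nonneg u.im])
    have hne := exp_sub_exp_ne_zero hc1 (cos_sub_le_of_lt_bdry hδ0.le (hδφ.trans hφ) hu hv)
    have hne2 := one_add_ne_zero_of_mem_sector hφ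
      (exp_mem_sector (v := v) (by rw [hv, abs_of_pos hδ0]; exact hδφ) hφ)
    simp only [hh]
    rw [hval _ (sub_ne_zero.1 hne), smul_eq_mul]
    simp only [hN]
    rw [← hz₀] at hne ⊢
    rw [add_comm] at hne2
    rw [add_comm 1 (Complex.exp v)]
    field_simp
    ring
  have hk3 := hk1.const_smul (f z₀)
  have h0 : bdryIntegral δ h = 0 := bdryIntegral_eq_zero hδ0.le ((hint.sub hk3).congr heq) hhd hC
  rw [← bdryIntegral_congr heq, bdryIntegral_sub hint hk3, bdryIntegral_const_smul, hk2,
    sub_eq_zero] at h0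
  rw [h0, smul_eq_mul, mul_comm]

/-! ### The Cauchy integral over the resolvent -/

lemma bdryIntegral_swap {Y : Type*} [NormedAddCommGroup Y] [NormedSpace ℂ Y] {δ₁ δ₂ : ℝ}
    {F E : ℂ → ℂ} (hF : BdryIntegrable δ₂ F) (hE : BdryIntegrable δ₁ E) {K : ℂ → ℂ → Y}
    (hKc : ∀ v u : ℂ, |v.im| = |δ₂| → |u.im| = |δ₁| → ContinuousAt (Function.uncurry K) (v, u))
    {C : ℝ} (hKb : ∀ v u : ℂ, |v.im| = |δ₂| → |u.im| = |δ₁| → ‖K v u‖ ≤ C) :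
    bdryIntegral δ₂ (fun v => bdryIntegral δ₁ fun u => (F v * E u) • K v u)
      = bdryIntegral δ₁ (fun u => bdryIntegral δ₂ fun v => (F v * E u) • K v u) := by
  have key : ∀ y₂ y₁ : ℝ, |y₂| = |δ₂| → |y₁| = |δ₁| → Integrable (fun x => F (horiz y₂ x)) →
      Integrable (fun x => E (horiz y₁ x)) →
      Integrable (Function.uncurry fun s t : ℝ =>
        (F (horiz y₂ s) * E (horiz y₁ t)) • K (horiz y₂ s) (horiz y₁ t))
        ((volume : Measure ℝ).prod volume) := by
    intro y₂ y₁ h₂ h₁ i₂ i₁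
    refine (i₂.mul_prod i₁).smul_bdd C (f := fun p : ℝ × ℝ => K (horiz y₂ p.1) (horiz y₁ p.2))
      (Continuous.aestronglyMeasurable ?_)
      (Eventually.of_forall fun p => hKb _ _ (by simpa using h₂) (by simpa using h₁))
    rw [continuous_iff_continuousAt]
    intro p
    exact ContinuousAt.comp (f := fun p : ℝ × ℝ => (horiz y₂ p.1, horiz y₁ p.2))
      (hKc (horiz y₂ p.1) (horiz y₁ p.2) (by simpa using h₂) (by simpa using h₁))
      (by fun_prop)
  have i11 := key (-δ₂) (-δ₁) (by simp) (by simp) hF.1 hE.1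
  have i12 := key (-δ₂) δ₁ (by simp) (by simp) hF.1 hE.2
  have i21 := key δ₂ (-δ₁) (by simp) (by simp) hF.2 hE.1
  have i22 := key δ₂ δ₁ (by simp) (by simp) hF.2 hE.2
  have l11 := i11.integral_prod_left
  have l12 := i12.integral_prod_left
  have l21 := i21.integral_prod_left
  have l22 := i22.integral_prod_left
  have r11 := i11.integral_prod_right
  have r12 := i12.integral_prod_right
  have r21 := i21.integral_prod_right
  have r22 := i22.integral_prod_right
  simp only [Function.uncurry_apply_pair] at l11 l12 l21 l22 r11 r12 r21 r22
  simp only [bdryIntegral]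
  rw [integral_sub l11 l12, integral_sub l21 l22, integral_sub r11 r21, integral_sub r12 r22,
    integral_integral_swap i11, integral_integral_swap i12, integral_integral_swap i21,
    integral_integral_swap i22]
  abel

section Operator

variable {X : Type*} [NormedAddCommGroup X] [NormedSpace ℂ X] {A : X →ₗ.[ℂ] X}

/-- The function `z R(z, A)` in the logarithmic coordinate `v = log z`. -/
def resolventLog (A : X →ₗ.[ℂ] X) (v : ℂ) : X →L[ℂ] X :=
  Complex.exp v • resolventOp A (Complex.exp v)

lemma mem_resSet_exp (hA : IsSectorial A) {v : ℂ} (h : sectorialityAngle A < |v.im|)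
    (h' : |v.im| < 2 * Real.pi - sectorialityAngle A) : Complex.exp v ∈ resSet A :=
  mem_resSet_of_lt_abs_arg hA (lt_abs_arg_exp (sectorialityAngle_nonneg A) h h')

lemma differentiableAt_resolventLog (hA : IsSectorial A) {v : ℂ}
    (h : sectorialityAngle A < |v.im|) (h' : |v.im| < 2 * Real.pi - sectorialityAngle A) :
    DifferentiableAt ℂ (resolventLog A) v :=
  Complex.differentiable_exp.differentiableAt.smul
    ((differentiableAt_resolventOp hA (lt_abs_arg_exp (sectorialityAngle_nonneg A) h h')).comp v
      Complex.differentiable_exp.differentiableAt)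

lemma exists_norm_resolventLog_le (hA : IsSectorial A) {δ : ℝ} (hδ : sectorialityAngle A < δ)
    (hδπ : δ < Real.pi) :
    ∃ C : ℝ, 0 ≤ C ∧ ∀ v : ℂ, δ ≤ |v.im| → |v.im| ≤ 2 * Real.pi - δ → ‖resolventLog A v‖ ≤ C := by
  obtain ⟨α, hα1, hα2⟩ := exists_between hδ
  obtain ⟨C, hC0, hC⟩ := exists_norm_smul_resolventOp_le hA hα1 (hα2.trans hδπ)
  exact ⟨C, hC0, fun v h1 h2 => hC _ (lt_abs_arg_exp ((sectorialityAngle_nonneg A).trans hα1.le)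
    (by linarith) (by linarith))⟩

lemma contourIntegral_eq (A : X →ₗ.[ℂ] X) (δ : ℝ) (e : ℂ → ℂ) :
    contourIntegral A δ e = (2 * (Real.pi : ℂ) * Complex.I)⁻¹ •
      bdryIntegral δ (fun v => e (Complex.exp v) • resolventLog A v) := by
  have key : ∀ δ : ℝ, (∫ t in Ioi (0 : ℝ), (e (ray δ t) * ray δ 1) • resolventOp A (ray δ t))
      = ∫ x, e (Complex.exp (horiz δ x)) • resolventLog A (horiz δ x) := by
    intro δ
    rw [integral_Ioi_eq_integral_exp]
    refine integral_congr_ae (Eventually.of_forall fun x => ?_)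
    simp only
    rw [ray_exp, resolventLog, ← Complex.coe_smul, smul_smul, smul_smul, ← ray_exp]
    congr 1
    simp only [ray]
    push_cast
    ring
  rw [contourIntegral, bdryIntegral, key, key]

variable {φ δ : ℝ} {e f : ℂ → ℂ}

lemma MemE.bdryIntegrable_resolventLog (hA : IsSectorial A) (he : MemE φ e)
    (hδ : sectorialityAngle A < δ) (hδφ : δ < φ) (hφ : φ < Real.pi) :
    BdryIntegrable δ fun v => e (Complex.exp v) • resolventLog A v := by
  have h0 := sectorialityAngle_nonneg A
  have hδ0 : |δ| = δ := abs_of_nonneg (by linarith)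
  obtain ⟨C, -, hC⟩ := exists_norm_resolventLog_le hA hδ (hδφ.trans hφ)
  refine (he.bdryIntegrable (by rwa [hδ0])).smul_bdd (g := resolventLog A)
    (fun v hv => (differentiableAt_resolventLog hA ?_ ?_).continuousAt)
    (fun v hv => hC v ?_ ?_) <;> rw [hv, hδ0] <;> linarith

lemma contourIntegral_eq_of_le (hA : IsSectorial A) (he : MemE φ e) {δ₁ δ₂ : ℝ}
    (hδ : sectorialityAngle A < δ₁) (h12 : δ₁ ≤ δ₂) (hδφ : δ₂ < φ) (hφ : φ < Real.pi) :
    contourIntegral A δ₁ e = contourIntegral A δ₂ e := by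
  have h0 := sectorialityAngle_nonneg A
  obtain ⟨C, hC0, hC⟩ := exists_norm_resolventLog_le hA hδ (by linarith)
  obtain ⟨D, hD⟩ := he.1.2
  rw [contourIntegral_eq, contourIntegral_eq, bdryIntegral_eq_of_le (by linarith) h12
    (he.bdryIntegrable_resolventLog hA hδ (by linarith) hφ)
    (he.bdryIntegrable_resolventLog hA (by linarith) hδφ hφ) (C := D * C)]
  · intro v h1 h2
    exact (he.1.differentiableAt_comp_exp hφ (by linarith)).smul
      (differentiableAt_resolventLog hA (by linarith) (by linarith))
  · intro v h1 h2
    have h3 := hD _ (exp_mem_sector (v := v) (h2.trans_lt hδφ) hφ)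
    rw [norm_smul]
    exact mul_le_mul h3 (hC v h1 (by linarith)) (norm_nonneg _) ((norm_nonneg _).trans h3)

/-- The Cauchy integral may be computed on any admissible contour. -/
lemma cauchyCalc_eq (hA : IsSectorial A) (he : MemE φ e)
    (hδ : sectorialityAngle A < δ) (hδφ : δ < φ) (hφ : φ < Real.pi) :
    cauchyCalc A φ e = contourIntegral A δ e := by
  rw [cauchyCalc]
  rcases le_total ((sectorialityAngle A + φ) / 2) δ with h | h
  · exact contourIntegral_eq_of_le hA he (by linarith) h hδφ hφ
  · exact (contourIntegral_eq_of_le hA he hδ h (by linarith) hφ).symm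

lemma cauchyCalc_eq_bdryIntegral (hA : IsSectorial A) (he : MemE φ e)
    (hδ : sectorialityAngle A < δ) (hδφ : δ < φ) (hφ : φ < Real.pi) :
    cauchyCalc A φ e = (2 * (Real.pi : ℂ) * Complex.I)⁻¹ •
      bdryIntegral δ (fun v => e (Complex.exp v) • resolventLog A v) := by
  rw [cauchyCalc_eq hA he hδ hδφ hφ, contourIntegral_eq]

lemma cauchyCalc_mono (hA : IsSectorial A) {ψ : ℝ} (he : MemE φ e)
    (hψ : sectorialityAngle A < ψ) (hψφ : ψ ≤ φ) (hφ : φ < Real.pi) :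
    cauchyCalc A ψ e = cauchyCalc A φ e := by
  obtain ⟨δ, h1, h2⟩ := exists_between hψ
  rw [cauchyCalc_eq hA (he.mono hψφ) h1 h2 (hψφ.trans_lt hφ),
    cauchyCalc_eq hA he h1 (h2.trans_le hψφ) hφ]

lemma cauchyCalc_congr (hφ : sectorialityAngle A < φ) (hφπ : φ < Real.pi)
    (h : ∀ z ∈ sector φ, e z = f z) : cauchyCalc A φ e = cauchyCalc A φ f := by
  have h0 := sectorialityAngle_nonneg A
  rw [cauchyCalc, cauchyCalc, contourIntegral_eq, contourIntegral_eq]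
  congr 1
  refine bdryIntegral_congr fun v hv => ?_
  rw [h _ (exp_mem_sector _ hφπ)]
  rw [hv, abs_of_nonneg (by linarith)]
  linarith

lemma cauchyCalc_add (hA : IsSectorial A) (hφ : sectorialityAngle A < φ) (hφπ : φ < Real.pi)
    (he : MemE φ e) (hf : MemE φ f) :
    cauchyCalc A φ (e + f) = cauchyCalc A φ e + cauchyCalc A φ f := by
  obtain ⟨δ, h1, h2⟩ := exists_between hφ
  rw [cauchyCalc_eq_bdryIntegral hA he h1 h2 hφπ, cauchyCalc_eq_bdryIntegral hA hf h1 h2 hφπ,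
    cauchyCalc_eq_bdryIntegral hA (he.add hf) h1 h2 hφπ, ← smul_add, ← bdryIntegral_add
    (he.bdryIntegrable_resolventLog hA h1 h2 hφπ) (hf.bdryIntegrable_resolventLog hA h1 h2 hφπ)]
  simp only [Pi.add_apply, add_smul]

lemma cauchyCalc_const_mul (c : ℂ) :
    cauchyCalc A φ (fun z => c * e z) = c • cauchyCalc A φ e := by
  rw [cauchyCalc, cauchyCalc, contourIntegral_eq, contourIntegral_eq, smul_comm c,
    ← bdryIntegral_const_smul _ c]
  simp only [mul_smul]

lemma cauchyCalc_zero : cauchyCalc A φ 0 = 0 := by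
  simpa [Pi.zero_def] using cauchyCalc_const_mul (A := A) (φ := φ) (e := 0) 0

section Complete

variable [CompleteSpace X]

/-- `Φ(e) z R(z, A) = Φ(e z / (z - ·))` for `z = exp u` outside the contour: by the resolvent
identity this reduces to the vanishing of a scalar integral. -/
lemma contourIntegral_mul_resolventLog (hA : IsSectorial A) (he : MemE φ e)
    (hδ : sectorialityAngle A < δ) (hδφ : δ < φ) (hφ : φ < Real.pi) {u : ℂ} (hu : δ < |u.im|)
    (hu' : |u.im| ≤ Real.pi) :
    contourIntegral A δ e * resolventLog A u = (2 * (Real.pi : ℂ) * Complex.I)⁻¹ •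
      bdryIntegral δ (fun v => (e (Complex.exp v) *
        (Complex.exp u / (Complex.exp u - Complex.exp v))) • resolventLog A v) := by
  have h0 := sectorialityAngle_nonneg A
  have hδ0 : |δ| = δ := abs_of_nonneg (by linarith)
  have hi := he.bdryIntegrable_resolventLog hA hδ hδφ hφ
  obtain ⟨D, hD⟩ := he.1.2
  have hc1 := cos_abs_sub_lt_one (u := u) (by linarith) hu hu'
  have hc : ∀ v : ℂ, |v.im| ≤ δ → Real.cos (u.im - v.im) ≤ Real.cos (|u.im| - δ) := fun v hv => by
    rw [← neg_sub, Real.cos_neg]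
    exact cos_sub_le_of_abs_le hv hu.le hu'
  have hne : ∀ v : ℂ, |v.im| ≤ δ → Complex.exp u - Complex.exp v ≠ 0 := fun v hv =>
    exp_sub_exp_ne_zero hc1 (hc v hv)
  -- the scalar integral
  have hkd : ∀ v : ℂ, |v.im| ≤ δ → DifferentiableAt ℂ
      (fun v => Complex.exp v / (Complex.exp u - Complex.exp v)) v := fun v hv =>
    Complex.differentiable_exp.differentiableAt.div
      (Complex.differentiable_exp.differentiableAt.const_sub _) (hne v hv)
  have hscal_int : BdryIntegrable δ fun v => e (Complex.exp v) *
      (Complex.exp v / (Complex.exp u - Complex.exp v)) :=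
    (he.bdryIntegrable (by rwa [hδ0])).smul_bdd
      (g := fun v => Complex.exp v / (Complex.exp u - Complex.exp v))
      (fun v hv => (hkd v (by rw [hv, hδ0])).continuousAt)
      (fun v hv => norm_exp_div_sub_le' hc1 (hc v (by rw [hv, hδ0])))
  have hscal : bdryIntegral δ (fun v => e (Complex.exp v) *
      (Complex.exp v / (Complex.exp u - Complex.exp v))) = 0 := by
    refine bdryIntegral_eq_zero (by linarith) hscal_int (fun v hv =>
      (he.1.differentiableAt_comp_exp hφ (by linarith)).mul (hkd v hv))
      (C := D * sepConst (Real.cos (|u.im| - δ))) fun v hv => ?_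
    have h3 := hD _ (exp_mem_sector (v := v) (hv.trans_lt hδφ) hφ)
    rw [norm_mul]
    exact mul_le_mul h3 (norm_exp_div_sub_le' hc1 (hc v hv)) (norm_nonneg _)
      ((norm_nonneg _).trans h3)
  have hres : ∀ v : ℂ, |v.im| = |δ| →
      (e (Complex.exp v) • resolventLog A v) * resolventLog A u =
      (e (Complex.exp v) * (Complex.exp u / (Complex.exp u - Complex.exp v))) • resolventLog A v
      - (e (Complex.exp v) * (Complex.exp v / (Complex.exp u - Complex.exp v))) •
        resolventLog A u := by
    intro v hv
    rw [hδ0] at hv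
    have h1 := resolventOp_sub
      (mem_resSet_exp hA (v := v) (by rw [hv]; exact hδ) (by rw [hv]; linarith))
      (mem_resSet_exp hA (v := u) (by linarith) (by linarith))
    have h2 := hne v hv.le
    rw [smul_mul_assoc, mul_smul, mul_smul, ← smul_sub]
    congr 1
    have h3 : resolventOp A (Complex.exp v) * resolventOp A (Complex.exp u) =
        (Complex.exp u - Complex.exp v)⁻¹ •
          (resolventOp A (Complex.exp v) - resolventOp A (Complex.exp u)) := by
      rw [h1, smul_smul, inv_mul_cancel₀ h2, one_smul]
    simp only [resolventLog, smul_mul_assoc, mul_smul_comm, h3, smul_smul, smul_sub]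
    congr 2
    · field_simp
    · field_simp
  have hmul := bdryIntegral_clm_comp hi
    ((ContinuousLinearMap.mul ℂ (X →L[ℂ] X)).flip (resolventLog A u))
  simp only [ContinuousLinearMap.flip_apply, ContinuousLinearMap.mul_apply'] at hmul
  have hint1 := hi.clm_comp ((ContinuousLinearMap.mul ℂ (X →L[ℂ] X)).flip (resolventLog A u))
  simp only [ContinuousLinearMap.flip_apply, ContinuousLinearMap.mul_apply'] at hint1
  have hint3 := hscal_int.clm_comp (ContinuousLinearMap.smulRight
    (1 : ℂ →L[ℂ] ℂ) (resolventLog A u))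
  have hz := bdryIntegral_clm_comp hscal_int (ContinuousLinearMap.smulRight
    (1 : ℂ →L[ℂ] ℂ) (resolventLog A u))
  simp only [ContinuousLinearMap.smulRight_apply, one_apply_eq_self] at hint3 hz
  have hint2 : BdryIntegrable δ fun v => (e (Complex.exp v) *
      (Complex.exp u / (Complex.exp u - Complex.exp v))) • resolventLog A v := by
    refine (hint1.add hint3).congr fun v hv => ?_
    rw [hres v hv, sub_add_cancel]
  rw [contourIntegral_eq, smul_mul_assoc, ← hmul, bdryIntegral_congr hres,
    bdryIntegral_sub hint2 hint3, hz, hscal, zero_smul, sub_zero]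

/-- The Cauchy integral is multiplicative on `𝓔`: with one factor on an inner and the other on an
outer contour, the resolvent identity, Fubini and the scalar Cauchy formula give the result. -/
lemma cauchyCalc_mul (hA : IsSectorial A) (hφ : sectorialityAngle A < φ) (hφπ : φ < Real.pi)
    (he : MemE φ e) (hf : MemE φ f) :
    cauchyCalc A φ (e * f) = cauchyCalc A φ e * cauchyCalc A φ f := by
  have h0 := sectorialityAngle_nonneg A
  obtain ⟨δ₁, h1, h1φ⟩ := exists_between hφ
  obtain ⟨δ₂, h12, h2φ⟩ := exists_between h1φ
  have hδ₁ : |δ₁| = δ₁ := abs_of_nonneg (by linarith)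
  have hδ₂ : |δ₂| = δ₂ := abs_of_nonneg (by linarith)
  set κ : ℂ := 2 * (Real.pi : ℂ) * Complex.I with hκ
  have hκ0 : κ ≠ 0 := Complex.two_pi_I_ne_zero
  have hif := hf.bdryIntegrable_resolventLog hA (h1.trans h12) h2φ hφπ
  have hmul := bdryIntegral_clm_comp hif
    (ContinuousLinearMap.mul ℂ (X →L[ℂ] X) (cauchyCalc A φ e))
  simp only [ContinuousLinearMap.mul_apply'] at hmul
  obtain ⟨C, hC0, hC⟩ := exists_norm_resolventLog_le hA h1 (h1φ.trans hφπ)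
  have hc : ∀ v u : ℂ, |v.im| = |δ₂| → |u.im| = |δ₁| →
      Real.cos (v.im - u.im) ≤ Real.cos (δ₂ - δ₁) := by
    intro v u hv hu
    rw [hδ₁] at hu
    rw [hδ₂] at hv
    have := cos_sub_le_of_abs_le (u := v) (v := u) (δ := δ₁) hu.le (by rw [hv]; exact h12.le)
      (by rw [hv]; linarith)
    rwa [hv, ← neg_sub, Real.cos_neg] at this
  have hc1 : Real.cos (δ₂ - δ₁) < 1 := cos_lt_one (by linarith) (by linarith)
  have hstep : ∀ v : ℂ, |v.im| = |δ₂| →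
      cauchyCalc A φ e * (f (Complex.exp v) • resolventLog A v) =
      κ⁻¹ • bdryIntegral δ₁ (fun u => (f (Complex.exp v) * e (Complex.exp u)) •
        ((Complex.exp v / (Complex.exp v - Complex.exp u)) • resolventLog A u)) := by
    intro v hv
    rw [hδ₂] at hv
    rw [mul_smul_comm, cauchyCalc_eq hA he h1 h1φ hφπ,
      contourIntegral_mul_resolventLog hA he h1 h1φ hφπ (by rw [hv]; exact h12)
        (by rw [hv]; linarith), smul_comm, ← bdryIntegral_const_smul]
    simp only [smul_smul, mul_assoc, hκ]
  have hinner : ∀ u : ℂ, |u.im| = |δ₁| →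
      bdryIntegral δ₂ (fun v => (f (Complex.exp v) * e (Complex.exp u)) •
        ((Complex.exp v / (Complex.exp v - Complex.exp u)) • resolventLog A u)) =
      κ • ((e * f) (Complex.exp u) • resolventLog A u) := by
    intro u hu
    rw [hδ₁] at hu
    have h3 := hf.bdryIntegrable_cauchy (u := u) (by rw [hu]; exact h12) h2φ hφπ
    have h4 := hf.cauchy_formula (u := u) (by rw [hu]; exact h12) h2φ hφπ
    have h5 := bdryIntegral_clm_comp h3 (ContinuousLinearMap.smulRight
      (1 : ℂ →L[ℂ] ℂ) (e (Complex.exp u) • resolventLog A u))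
    simp only [ContinuousLinearMap.smulRight_apply, one_apply_eq_self] at h5
    rw [h4] at h5
    simp only [smul_smul, Pi.mul_apply] at h5 ⊢
    rw [show κ * (e (Complex.exp u) * f (Complex.exp u))
      = κ * f (Complex.exp u) * e (Complex.exp u) by ring, ← h5]
    congr 1
    funext v
    congr 1
    ring
  rw [cauchyCalc_eq_bdryIntegral hA hf (h1.trans h12) h2φ hφπ, mul_smul_comm, ← hmul,
    bdryIntegral_congr hstep, bdryIntegral_const_smul,
    bdryIntegral_swap (F := fun v => f (Complex.exp v)) (E := fun u => e (Complex.exp u))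
      (K := fun v u => (Complex.exp v / (Complex.exp v - Complex.exp u)) • resolventLog A u)
      (hf.bdryIntegrable (by rwa [hδ₂])) (he.bdryIntegrable (by rwa [hδ₁]))
      (C := sepConst (Real.cos (δ₂ - δ₁)) * C),
    bdryIntegral_congr hinner, bdryIntegral_const_smul, ← hκ, smul_smul κ⁻¹ κ,
    inv_mul_cancel₀ hκ0, one_smul,
    cauchyCalc_eq_bdryIntegral hA (he.mul hφπ hf.1) h1 h1φ hφπ]
  · intro v u hv hu
    have hne := exp_sub_exp_ne_zero hc1 (hc v u hv hu)
    rw [hδ₁] at hu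
    have h6 := (differentiableAt_resolventLog hA (v := u) (by rw [hu]; exact h1)
      (by rw [hu]; linarith)).continuousAt
    refine ContinuousAt.smul (f := fun p : ℂ × ℂ => Complex.exp p.1 /
      (Complex.exp p.1 - Complex.exp p.2)) (g := fun p : ℂ × ℂ => resolventLog A p.2)
      (ContinuousAt.div (by fun_prop) (by fun_prop) hne) ?_
    exact ContinuousAt.comp (f := fun p : ℂ × ℂ => p.2) (x := (v, u)) h6 continuousAt_snd
  · intro v u hv hu
    have h7 := norm_exp_div_sub_le hc1 (hc v u hv hu)
    rw [hδ₁] at hu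
    rw [norm_smul]
    exact mul_le_mul h7 (hC u (by rw [hu]) (by rw [hu]; linarith)) (norm_nonneg _)
      (sepConst_nonneg _)

end Complete

end Operator

/-! ### Resolvents at negative points -/

section NegativeResolvent

variable {X : Type*} [NormedAddCommGroup X] [NormedSpace ℂ X] {A : X →ₗ.[ℂ] X}

/-- The operator `t (t + A)⁻¹`, for `t > 0`. -/
def shiftInv (A : X →ₗ.[ℂ] X) (t : ℝ) : X →L[ℂ] X := -((t : ℂ) • resolventOp A (-(t : ℂ)))

lemma shiftInv_one (A : X →ₗ.[ℂ] X) : shiftInv A 1 = invOneAdd A := by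
  simp [shiftInv, invOneAdd]

lemma resolventLog_horiz_pi (A : X →ₗ.[ℂ] X) (x : ℝ) :
    resolventLog A (horiz Real.pi x) = shiftInv A (Real.exp x) := by
  rw [resolventLog, exp_horiz_pi, shiftInv, neg_smul]

variable (hA : IsSectorial A) (hπ : sectorialityAngle A < Real.pi)
include hA hπ

lemma neg_mem_resSet {t : ℝ} (ht : 0 < t) : -(t : ℂ) ∈ resSet A := by
  refine mem_resSet_of_lt_abs_arg hA ?_
  rwa [← Complex.ofReal_neg, Complex.arg_ofReal_of_neg (neg_lt_zero.2 ht), abs_of_pos Real.pi_pos]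

lemma neg_one_mem_resSet : (-1 : ℂ) ∈ resSet A := by
  simpa using neg_mem_resSet hA hπ one_pos

lemma invOneAdd_injective {y : X} (hy : invOneAdd A y = 0) : y = 0 := by
  have h1 : resolventOp A (-1) y = 0 := by simpa [invOneAdd] using hy
  obtain ⟨h2, e⟩ := (isResolventAt_resolventOp (neg_one_mem_resSet hA hπ)).1 y
  have h3 : (⟨resolventOp A (-1) y, h2⟩ : A.domain) = 0 := Subtype.ext h1
  rw [h3, LinearPMap.map_zero, h1, smul_zero, sub_zero] at e
  exact e.symm

/-- The resolvent identity with base point `-1`. -/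
lemma resolventOp_add_invOneAdd {z : ℂ} (hz : z ∈ resSet A) :
    resolventOp A z + invOneAdd A = (1 + z) • (resolventOp A z * invOneAdd A) := by
  have h := resolventOp_sub hz (neg_one_mem_resSet hA hπ)
  rw [invOneAdd, ← sub_eq_add_neg, h, mul_neg, smul_neg, ← neg_smul]
  congr 1
  ring

lemma commute_resolventOp_invOneAdd {z : ℂ} (hz : z ∈ resSet A) :
    Commute (resolventOp A z) (invOneAdd A) :=
  (resolventOp_commute hz (neg_one_mem_resSet hA hπ)).neg_right

lemma shiftInv_apply_of_fixed {t : ℝ} (ht : 0 < t) {y : X} (hy : invOneAdd A y = y) :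
    shiftInv A t y = y := by
  have h := congrArg (fun T : X →L[ℂ] X => T y)
    (resolventOp_add_invOneAdd hA hπ (neg_mem_resSet hA hπ ht))
  have h' : resolventOp A (-(t : ℂ)) y + invOneAdd A y
      = (1 + -(t : ℂ)) • resolventOp A (-(t : ℂ)) (invOneAdd A y) := h
  rw [hy, add_smul, one_smul, add_right_inj, neg_smul] at h'
  exact h'.symm

lemma exists_norm_shiftInv_le : ∃ C : ℝ, ∀ t : ℝ, 0 < t → ‖shiftInv A t‖ ≤ C := by
  obtain ⟨δ, h1, h2⟩ := exists_between hπ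
  obtain ⟨C, -, hC⟩ := exists_norm_resolventLog_le hA h1 h2
  refine ⟨C, fun t ht => ?_⟩
  have := hC (horiz Real.pi (Real.log t)) (by
    rw [horiz_im, abs_of_pos Real.pi_pos]; exact h2.le) (by
    rw [horiz_im, abs_of_pos Real.pi_pos]; linarith)
  rwa [resolventLog_horiz_pi, Real.exp_log ht] at this

end NegativeResolvent

/-! ### Further properties of the Cauchy integral -/

section Cauchy

variable {X : Type*} [NormedAddCommGroup X] [NormedSpace ℂ X]
  {A : X →ₗ.[ℂ] X} {φ : ℝ} {e : ℂ → ℂ}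
  (hA : IsSectorial A) (hφ : sectorialityAngle A < φ) (hφπ : φ < Real.pi)
include hA hφ hφπ

/-- Dominated convergence for the Cauchy integral. -/
lemma tendsto_cauchyCalc_mul (he : MemE φ e) {f : ℕ → ℂ → ℂ} (hf : ∀ n, MemHInf φ (f n)) {C : ℝ}
    (hC : ∀ n, ∀ z ∈ sector φ, ‖f n z‖ ≤ C)
    (hlim : ∀ z ∈ sector φ, Tendsto (fun n => f n z) atTop (𝓝 0)) :
    Tendsto (fun n => cauchyCalc A φ (e * f n)) atTop (𝓝 0) := by
  obtain ⟨δ, h1, h2⟩ := exists_between hφ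
  have hδ0 : |δ| = δ := abs_of_nonneg ((sectorialityAngle_nonneg A).trans h1.le)
  have hi := he.bdryIntegrable_resolventLog hA h1 h2 hφπ
  have key : ∀ y : ℝ, |y| = δ →
      Integrable (fun x => e (Complex.exp (horiz y x)) • resolventLog A (horiz y x)) →
      (∀ n, Integrable fun x => (e * f n) (Complex.exp (horiz y x)) •
        resolventLog A (horiz y x)) →
      Tendsto (fun n => ∫ x, (e * f n) (Complex.exp (horiz y x)) • resolventLog A (horiz y x))
        atTop (𝓝 0) := by
    intro y hy hi1 hi2
    have hmem : ∀ x, Complex.exp (horiz y x) ∈ sector φ := fun x =>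
      exp_mem_sector (by rw [horiz_im, hy]; exact h2) hφπ
    have hre : ∀ n x, (e * f n) (Complex.exp (horiz y x)) • resolventLog A (horiz y x)
        = f n (Complex.exp (horiz y x)) •
          (e (Complex.exp (horiz y x)) • resolventLog A (horiz y x)) := fun n x => by
      rw [smul_smul, Pi.mul_apply, mul_comm]
    rw [← integral_zero ℝ (X →L[ℂ] X)]
    refine tendsto_integral_of_dominated_convergence
      (fun x => C * ‖e (Complex.exp (horiz y x)) • resolventLog A (horiz y x)‖)
      (fun n => (hi2 n).1) (hi1.norm.const_mul C)
      (fun n => Eventually.of_forall fun x => ?_) (Eventually.of_forall fun x => ?_)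
    · rw [hre, norm_smul]
      gcongr
      exact hC n _ (hmem x)
    · simp only [hre]
      simpa using (hlim _ (hmem x)).smul_const
        (e (Complex.exp (horiz y x)) • resolventLog A (horiz y x))
  have hi2 := fun n => (he.mul hφπ (hf n)).bdryIntegrable_resolventLog hA h1 h2 hφπ
  have h3 := ((key (-δ) (by rw [abs_neg, hδ0]) hi.1 fun n => (hi2 n).1).sub
    (key δ hδ0 hi.2 fun n => (hi2 n).2)).const_smul (2 * (Real.pi : ℂ) * Complex.I)⁻¹
  rw [sub_zero, smul_zero] at h3
  refine h3.congr fun n => ?_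
  rw [cauchyCalc_eq_bdryIntegral hA (he.mul hφπ (hf n)) h1 h2 hφπ]
  rfl

variable [CompleteSpace X]

lemma cauchyCalc_mul_shiftInv (he : MemE φ e) {t : ℝ} (ht : 0 < t) :
    cauchyCalc A φ e * shiftInv A t = cauchyCalc A φ (e * fun z => (t : ℂ) / (t + z)) := by
  obtain ⟨δ, h1, h2⟩ := exists_between hφ
  have h3 := contourIntegral_mul_resolventLog hA he h1 h2 hφπ (u := horiz Real.pi (Real.log t))
    (by rw [horiz_im, abs_of_pos Real.pi_pos]; linarith)
    (by rw [horiz_im, abs_of_pos Real.pi_pos])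
  rw [resolventLog_horiz_pi, exp_horiz_pi, Real.exp_log ht] at h3
  rw [cauchyCalc_eq hA he h1 h2 hφπ, h3,
    cauchyCalc_eq_bdryIntegral hA (he.mul hφπ (memHInf_div_add hφπ ht)) h1 h2 hφπ]
  congr 2
  funext v
  congr 2
  rw [← neg_add', neg_div_neg_eq]

/-- An operator that commutes with the resolvents commutes with the Cauchy integral. -/
lemma commute_cauchyCalc (he : MemE φ e) {U : X →L[ℂ] X}
    (hU : ∀ z ∈ resSet A, Commute (resolventOp A z) U) : Commute (cauchyCalc A φ e) U := by
  have h0 := sectorialityAngle_nonneg A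
  obtain ⟨δ, h1, h2⟩ := exists_between hφ
  have hi := he.bdryIntegrable_resolventLog hA h1 h2 hφπ
  have hl := bdryIntegral_clm_comp hi (ContinuousLinearMap.mul ℂ (X →L[ℂ] X) U)
  have hr := bdryIntegral_clm_comp hi ((ContinuousLinearMap.mul ℂ (X →L[ℂ] X)).flip U)
  simp only [ContinuousLinearMap.flip_apply, ContinuousLinearMap.mul_apply'] at hl hr
  rw [cauchyCalc_eq_bdryIntegral hA he h1 h2 hφπ]
  refine Commute.smul_left ?_ _
  rw [commute_iff_eq, ← hl, ← hr]
  refine bdryIntegral_congr fun v hv => ?_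
  rw [abs_of_nonneg (h0.trans h1.le)] at hv
  exact (((hU _ (mem_resSet_exp hA (by rw [hv]; exact h1)
    (by rw [hv]; linarith))).smul_left _).smul_left _).eq

lemma commute_cauchyCalc_invOneAdd (he : MemE φ e) : Commute (cauchyCalc A φ e) (invOneAdd A) :=
  commute_cauchyCalc hA hφ hφπ he fun _ hz => commute_resolventOp_invOneAdd hA (hφ.trans hφπ) hz

lemma commute_cauchyCalc_shiftInv (he : MemE φ e) {t : ℝ} (ht : 0 < t) :
    Commute (cauchyCalc A φ e) (shiftInv A t) :=
  commute_cauchyCalc hA hφ hφπ he fun _ hz => ((resolventOp_commute hz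
    (neg_mem_resSet hA (hφ.trans hφπ) ht)).smul_right _).neg_right

/-- The range of `Φ(e)` is contained in the space on which `t (t + A)⁻¹ → 0` as `t ↘ 0`. -/
lemma tendsto_cauchyCalc_mul_shiftInv (he : MemE φ e) :
    Tendsto (fun n : ℕ => cauchyCalc A φ e * shiftInv A (1 / ((n : ℝ) + 1))) atTop (𝓝 0) := by
  have hpos : ∀ n : ℕ, 0 < 1 / ((n : ℝ) + 1) := fun n => by positivity
  obtain ⟨K, hK⟩ := exists_norm_div_add_le hφπ
  have h := tendsto_cauchyCalc_mul hA hφ hφπ he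
    (f := fun n z => ((1 / ((n : ℝ) + 1) : ℝ) : ℂ) / (((1 / ((n : ℝ) + 1) : ℝ) : ℂ) + z))
    (fun n => memHInf_div_add hφπ (hpos n)) (C := K) (fun n z hz => (hK _ (hpos n) z hz).2)
    (fun z hz => by
      have h0 : Tendsto (fun n : ℕ => (((1 / ((n : ℝ) + 1) : ℝ)) : ℂ)) atTop (𝓝 ((0 : ℝ) : ℂ)) :=
        (Complex.continuous_ofReal.tendsto _).comp tendsto_one_div_add_atTop_nhds_zero_nat
      have h1 := Tendsto.div h0 (h0.add_const z) (by simpa using hz.1)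
      rw [Complex.ofReal_zero, zero_div] at h1
      exact h1)
  exact h.congr fun n => (cauchyCalc_mul_shiftInv hA hφ hφπ he (hpos n)).symm

/-- Elements of `𝓔` vanish at `0`: their images annihilate the kernel of `A`. -/
lemma cauchyCalc_apply_of_fixed (he : MemE φ e) {x : X} (hx : invOneAdd A x = x) :
    cauchyCalc A φ e x = 0 := by
  have h1 := (tendsto_cauchyCalc_mul_shiftInv hA hφ hφπ he)
  have h2 := ((ContinuousLinearMap.apply ℂ X x).continuous.tendsto _).comp h1
  have h3 : (fun n : ℕ => cauchyCalc A φ e x) = (ContinuousLinearMap.apply ℂ X x) ∘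
      (fun n : ℕ => cauchyCalc A φ e * shiftInv A (1 / ((n : ℝ) + 1))) := by
    funext n
    change cauchyCalc A φ e x = cauchyCalc A φ e (shiftInv A (1 / ((n : ℝ) + 1)) x)
    rw [shiftInv_apply_of_fixed hA (hφ.trans hφπ) (by positivity) hx]
  rw [← h3, map_zero] at h2
  exact tendsto_nhds_unique tendsto_const_nhds h2

omit [CompleteSpace X] hA hφ hφπ in
lemma smul_principal_part {z : ℂ} (h₁ : 1 + z ≠ 0) (h₂ : z - 1 ≠ 0) (b c p : X) :
    z • (z • p - (b - (2⁻¹ : ℂ) • (4 : ℂ) • (b - c))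
      - ((4⁻¹ : ℂ) * (z / (z - 1))) • (4 : ℂ) • (b - c)) =
    qFun z • (z • (-b - (1 + z) • c + ((1 + z) * (1 + z)) • p)
      - (b - (2⁻¹ : ℂ) • (4 : ℂ) • (b - c)) - (z / (z - 1)) • (4 : ℂ) • (b - c)) := by
  rw [qFun]
  match_scalars <;> field_simp <;> ring

/-- The value of the calculus at `z / (1 + z)² = (1 + z)⁻¹ - (1 + z)⁻²`. The contour is pushed
outwards across the double pole at `-1`; the principal part of the resolvent there is matched by a
combination of the functions `1 / z` and `1 / (z - 1)`, whose integrals against `z / (1 + z)²` are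
known. -/
lemma cauchyCalc_qFun :
    cauchyCalc A φ qFun = invOneAdd A - invOneAdd A * invOneAdd A := by
  obtain ⟨δ, h1, h2⟩ := exists_between hφ
  have h0 := sectorialityAngle_nonneg A
  have hδ0 : |δ| = δ := abs_of_nonneg (h0.trans h1.le)
  have hδpos : 0 < δ := h0.trans_lt h1
  have hq := memE_qFun hφπ
  set B := invOneAdd A with hB
  set X₂ : X →L[ℂ] X := (4 : ℂ) • (B - B * B) with hX₂
  set X₁ : X →L[ℂ] X := B - (2⁻¹ : ℂ) • X₂ with hX₁
  obtain ⟨C, hC0, hC⟩ := exists_norm_resolventLog_le hA h1 (h2.trans hφπ)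
  set k : ℂ → ℂ := fun v => Complex.exp v / (Complex.exp v - Complex.exp 0) with hk
  have hc1 : Real.cos δ < 1 := cos_lt_one hδpos (by linarith)
  have hc : ∀ v : ℂ, v.im ∈ Icc δ (2 * Real.pi - δ) →
      Real.cos (v.im - (0 : ℂ).im) ≤ Real.cos δ := fun v hv => by
    have h : |v.im - (0 : ℂ).im| = v.im := by
      rw [Complex.zero_im, sub_zero, abs_of_nonneg (by linarith [hv.1])]
    exact cos_le_cos_of_abs_mem hδpos.le (by rw [h]; exact hv.1) (by rw [h]; exact hv.2)
  have habs : ∀ v : ℂ, v.im ∈ Icc δ (2 * Real.pi - δ) → |v.im| = v.im := fun v hv =>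
    abs_of_nonneg (by linarith [hv.1])
  set h : ℂ → X →L[ℂ] X := fun v => Complex.exp v • (resolventLog A v * (B * B) - X₁
    - ((4⁻¹ : ℂ) * k v) • X₂) with hh
  have hid : ∀ v : ℂ, δ ≤ |v.im| → |v.im| ≤ 2 * Real.pi - δ → 1 + Complex.exp v ≠ 0 →
      Complex.exp v - 1 ≠ 0 →
      h v = qFun (Complex.exp v) • (resolventLog A v - X₁ - k v • X₂) := by
    intro v hv1 hv2 hne1 hne2
    have hz := Complex.exp_ne_zero v
    have hres := resolventOp_add_invOneAdd hA (hφ.trans hφπ)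
      (mem_resSet_exp hA (v := v) (by linarith) (by linarith))
    simp only [hh, hk, resolventLog, Complex.exp_zero]
    set z := Complex.exp v
    set R := resolventOp A z
    rw [← hB] at hres
    have hR : R = -B - (1 + z) • (B * B) + ((1 + z) * (1 + z)) • (R * (B * B)) := by
      have e1 : R = (1 + z) • (R * B) - B := by rw [← hres]; abel
      have e2 : R * B = (1 + z) • (R * (B * B)) - B * B := by
        conv_lhs => rw [e1]
        rw [sub_mul, smul_mul_assoc, mul_assoc]
      rw [e2, smul_sub, smul_smul] at e1
      conv_lhs => rw [e1]
      abel
    rw [smul_mul_assoc, hX₁, hX₂]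
    conv_rhs => rw [hR]
    exact smul_principal_part hne1 hne2 B (B * B) (R * (B * B))
  have hper : ∀ x, h (horiz (-δ) x) = h (horiz (2 * Real.pi - δ) x) := fun x => by
    have h3 : Complex.exp (horiz (2 * Real.pi - δ) x) = Complex.exp (horiz (-δ) x) := by
      rw [← Complex.exp_periodic (horiz (-δ) x)]
      congr 1
      simp only [horiz]
      push_cast
      ring
    simp only [hh, hk, resolventLog, h3]
  -- integrability on the two lines
  have hi₁ := hq.bdryIntegrable_resolventLog hA h1 h2 hφπ
  have hi₂ := (hq.bdryIntegrable (by rwa [hδ0])).clm_comp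
    (ContinuousLinearMap.smulRight (1 : ℂ →L[ℂ] ℂ) X₁)
  have hq₃ := hq.bdryIntegrable_cauchy (u := 0) (by simpa using hδpos) h2 hφπ
  have hi₃ := hq₃.clm_comp (ContinuousLinearMap.smulRight (1 : ℂ →L[ℂ] ℂ) X₂)
  have hb₂ := bdryIntegral_clm_comp (hq.bdryIntegrable (by rwa [hδ0]))
    (ContinuousLinearMap.smulRight (1 : ℂ →L[ℂ] ℂ) X₁)
  have hb₃ := bdryIntegral_clm_comp hq₃ (ContinuousLinearMap.smulRight (1 : ℂ →L[ℂ] ℂ) X₂)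
  simp only [ContinuousLinearMap.smulRight_apply, one_apply_eq_self] at hi₂ hi₃ hb₂ hb₃
  obtain ⟨Q, hQ⟩ := hq.1.2
  rw [bdryIntegral_eq_zero hδpos.le (hq.bdryIntegrable (by rwa [hδ0]))
    (fun v hv => hq.1.differentiableAt_comp_exp hφπ (by linarith))
    (fun v hv => hQ _ (exp_mem_sector (by linarith) hφπ)), zero_smul] at hb₂
  rw [hq.cauchy_formula (u := 0) (by simpa using hδpos) h2 hφπ] at hb₃
  have heq : ∀ v : ℂ, |v.im| = |δ| → qFun (Complex.exp v) • resolventLog A v -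
      qFun (Complex.exp v) • X₁ - (qFun (Complex.exp v) * k v) • X₂ = h v := by
    intro v hv
    have hc2 := cos_sub_le_of_lt_bdry (u := 0) hδpos.le (h2.trans hφπ) (by simpa using hδpos) hv
    rw [hδ0] at hv
    have h3 := exp_sub_exp_ne_zero (by simpa using hc1) hc2
    rw [Complex.exp_zero] at h3
    rw [hid v hv.ge (by rw [hv]; linarith) (one_add_ne_zero_of_mem_sector hφπ
      (exp_mem_sector (by rw [hv]; exact h2) hφπ)) h3, smul_sub _ (resolventLog A v - X₁),
      smul_sub _ (resolventLog A v) X₁, smul_smul (qFun (Complex.exp v)) (k v)]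
  have hih : BdryIntegrable δ h := ((hi₁.sub hi₂).sub hi₃).congr heq
  -- a uniform bound on the outer strip, treating the neighbourhood of `-1` separately
  have hbound : ∀ v : ℂ, v.im ∈ Icc δ (2 * Real.pi - δ) → ‖h v‖ ≤
      3 / 2 * (C * ‖B * B‖ + ‖X₁‖ + 4⁻¹ * sepConst (Real.cos δ) * ‖X₂‖) +
      6 * (C + ‖X₁‖ + sepConst (Real.cos δ) * ‖X₂‖) := by
    intro v hv
    have hK := sepConst_nonneg (Real.cos δ)
    have hkv : ‖k v‖ ≤ sepConst (Real.cos δ) := norm_exp_div_sub_le hc1 (hc v hv)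
    have hSv : ‖resolventLog A v‖ ≤ C := hC v (by rw [habs v hv]; exact hv.1)
      (by rw [habs v hv]; exact hv.2)
    rcases lt_or_ge ‖1 + Complex.exp v‖ (1 / 2) with h3 | h3
    · refine le_trans ?_ (le_add_of_nonneg_right (by positivity))
      have h4 : ‖Complex.exp v‖ ≤ 3 / 2 := by
        calc ‖Complex.exp v‖ = ‖(1 + Complex.exp v) - 1‖ := by rw [add_sub_cancel_left]
          _ ≤ ‖1 + Complex.exp v‖ + ‖(1 : ℂ)‖ := norm_sub_le _ _
          _ ≤ 3 / 2 := by rw [norm_one]; linarith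
      simp only [hh]
      rw [norm_smul]
      refine mul_le_mul h4 ((norm_sub_le _ _).trans (add_le_add ((norm_sub_le _ _).trans
        (add_le_add ((norm_mul_le _ _).trans ?_) le_rfl)) ?_)) (norm_nonneg _) (by norm_num)
      · gcongr
      · rw [norm_smul, norm_mul]
        gcongr
        norm_num
    · refine le_trans ?_ (le_add_of_nonneg_left (by positivity))
      have h4 : 1 + Complex.exp v ≠ 0 := fun h => by
        rw [h, norm_zero] at h3; norm_num at h3
      have h5 := exp_sub_exp_ne_zero hc1 (hc v hv)
      rw [Complex.exp_zero] at h5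
      have h6 : ‖(1 + Complex.exp v)⁻¹‖ ≤ 2 := by
        rw [norm_inv, inv_le_comm₀ (norm_pos_iff.2 h4) two_pos]
        linarith
      have h7 : ‖qFun (Complex.exp v)‖ ≤ 6 := by
        have h8 : qFun (Complex.exp v)
            = (1 - (1 + Complex.exp v)⁻¹) * (1 + Complex.exp v)⁻¹ := by
          rw [qFun]
          field_simp
          ring
        rw [h8, norm_mul]
        have h9 : ‖1 - (1 + Complex.exp v)⁻¹‖ ≤ 3 :=
          (norm_sub_le _ _).trans (by rw [norm_one]; linarith)
        calc _ ≤ (3 : ℝ) * 2 := mul_le_mul h9 h6 (norm_nonneg _) (by norm_num)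
          _ = 6 := by norm_num
      rw [hid v (by rw [habs v hv]; exact hv.1) (by rw [habs v hv]; exact hv.2) h4 h5, norm_smul]
      refine mul_le_mul h7 ((norm_sub_le _ _).trans (add_le_add ((norm_sub_le _ _).trans
        (add_le_add hSv le_rfl)) ?_)) (norm_nonneg _) (by norm_num)
      rw [norm_smul]
      gcongr
  have hdiff : ∀ v : ℂ, v.im ∈ Icc δ (2 * Real.pi - δ) → DifferentiableAt ℂ h v := by
    intro v hv
    have h3 := differentiableAt_resolventLog hA (v := v) (by rw [habs v hv]; linarith [hv.1])
      (by rw [habs v hv]; linarith [hv.2])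
    have h4 := differentiableAt_exp_div_sub (exp_sub_exp_ne_zero hc1 (hc v hv))
    exact Complex.differentiable_exp.differentiableAt.smul
      (((h3.mul_const _).sub_const _).sub ((h4.const_mul _).smul_const _))
  have hzero : bdryIntegral δ h = 0 := by
    have h3 : Integrable fun x => h (horiz (2 * Real.pi - δ) x) := by
      simpa only [hper] using hih.1
    rw [bdryIntegral, integral_horiz_eq (by linarith) hdiff hbound hih.2 h3]
    simp only [hper, sub_self]
  rw [← bdryIntegral_congr heq, bdryIntegral_sub (hi₁.sub hi₂) hi₃, bdryIntegral_sub hi₁ hi₂, hb₂,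
    hb₃, sub_zero, sub_eq_zero] at hzero
  rw [cauchyCalc_eq_bdryIntegral hA hq h1 h2 hφπ, hzero, smul_smul, ← mul_assoc,
    inv_mul_cancel₀ Complex.two_pi_I_ne_zero, hX₂, smul_smul, Complex.exp_zero, qFun]
  norm_num

end Cauchy

/-! ### The elementary calculus -/

lemma eq_zero_of_integrable_of_tendsto_atTop {F : ℝ → ℂ} (hF : Integrable F) {a : ℂ}
    (h : Tendsto F atTop (𝓝 a)) : a = 0 := by
  refine IntegrableAtFilter.eq_zero_of_tendsto (hF.integrableAtFilter atTop) (fun s hs => ?_) h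
  obtain ⟨b, hb⟩ := mem_atTop_sets.1 hs
  exact measure_mono_top (s₁ := Ici b) (fun x hx => hb x hx) Real.volume_Ici

lemma eq_zero_of_integrable_of_tendsto_atBot {F : ℝ → ℂ} (hF : Integrable F) {a : ℂ}
    (h : Tendsto F atBot (𝓝 a)) : a = 0 := by
  refine IntegrableAtFilter.eq_zero_of_tendsto (hF.integrableAtFilter atBot) (fun s hs => ?_) h
  obtain ⟨b, hb⟩ := mem_atBot_sets.1 hs
  exact measure_mono_top (s₁ := Iic b) (fun x hx => hb x hx) Real.volume_Iic

lemma ofReal_mem_sector {φ : ℝ} (hφ : 0 < φ) {t : ℝ} (ht : 0 < t) : (t : ℂ) ∈ sector φ :=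
  ⟨by exact_mod_cast ht.ne', by rwa [Complex.arg_ofReal_of_nonneg ht.le, abs_zero]⟩

lemma MemE.integrable_comp_exp {φ : ℝ} (hφ : 0 < φ) {e : ℂ → ℂ} (he : MemE φ e) :
    Integrable fun x : ℝ => e (Real.exp x : ℝ) := by
  have h := (memE_iff.1 he).2 0 (by simpa using hφ)
  simpa [horiz] using h

/-- A limit at the vertex of an element of `𝓔` can only be `0`. -/
lemma MemE.eq_zero_of_tendsto_zero {φ : ℝ} (hφ : 0 < φ) {e : ℂ → ℂ} (he : MemE φ e) {a : ℂ}
    (h : Tendsto (fun t : ℝ => e t) (𝓝[>] 0) (𝓝 a)) : a = 0 :=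
  eq_zero_of_integrable_of_tendsto_atBot (he.integrable_comp_exp hφ)
    (h.comp Real.tendsto_exp_atBot_nhdsGT)

/-- A limit at infinity of an element of `𝓔` can only be `0`. -/
lemma MemE.eq_zero_of_tendsto_atTop {φ : ℝ} (hφ : 0 < φ) {e : ℂ → ℂ} (he : MemE φ e) {a : ℂ}
    (h : Tendsto (fun t : ℝ => e t) atTop (𝓝 a)) : a = 0 :=
  eq_zero_of_integrable_of_tendsto_atTop (he.integrable_comp_exp hφ) (h.comp Real.tendsto_exp_atTop)

lemma tendsto_inv_one_add_zero : Tendsto (fun t : ℝ => (1 + (t : ℂ))⁻¹) (𝓝[>] 0) (𝓝 1) := by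
  have h : Tendsto (fun t : ℝ => (1 + (t : ℂ))⁻¹) (𝓝 0) (𝓝 (1 + ((0 : ℝ) : ℂ))⁻¹) :=
    ((Complex.continuous_ofReal.tendsto 0).const_add 1).inv₀ (by simp)
  simpa using h.mono_left nhdsWithin_le_nhds

lemma tendsto_inv_one_add_atTop : Tendsto (fun t : ℝ => (1 + (t : ℂ))⁻¹) atTop (𝓝 0) := by
  have h : Tendsto (fun t : ℝ => (1 + t)⁻¹) atTop (𝓝 0) :=
    tendsto_inv_atTop_zero.comp (tendsto_atTop_add_const_left _ 1 tendsto_id)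
  have := (Complex.continuous_ofReal.tendsto 0).comp h
  simpa [Function.comp_def] using this

/-- The sum `𝓔 ⊕ ℂ 1 ⊕ ℂ (1 + z)⁻¹` is direct. -/
lemma MemE.eq_zero_of_eq_add {φ : ℝ} (hφ : 0 < φ) {e : ℂ → ℂ} (he : MemE φ e) {c d : ℂ}
    (h : ∀ z ∈ sector φ, e z = c + d * (1 + z)⁻¹) : c = 0 ∧ d = 0 := by
  have h1 : c = 0 := by
    have h2 : Tendsto (fun t : ℝ => c + d * (1 + (t : ℂ))⁻¹) atTop (𝓝 (c + d * 0)) :=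
      (tendsto_inv_one_add_atTop.const_mul d).const_add c
    rw [mul_zero, add_zero] at h2
    refine he.eq_zero_of_tendsto_atTop hφ (h2.congr' ?_)
    filter_upwards [eventually_gt_atTop 0] with t ht using (h t (ofReal_mem_sector hφ ht)).symm
  have h3 : c + d = 0 := by
    have h2 : Tendsto (fun t : ℝ => c + d * (1 + (t : ℂ))⁻¹) (𝓝[>] 0) (𝓝 (c + d * 1)) :=
      (tendsto_inv_one_add_zero.const_mul d).const_add c
    rw [mul_one] at h2
    refine he.eq_zero_of_tendsto_zero hφ (h2.congr' ?_)
    filter_upwards [self_mem_nhdsWithin] with t ht using (h t (ofReal_mem_sector hφ ht)).symm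
  exact ⟨h1, by rwa [h1, zero_add] at h3⟩

section Elementary

variable {X : Type*} [NormedAddCommGroup X] [NormedSpace ℂ X]
  {A : X →ₗ.[ℂ] X} {φ : ℝ} {e f g : ℂ → ℂ} {B C : X →L[ℂ] X}

lemma ElemCalc.congr (hf : ElemCalc A φ f B) (h : ∀ z ∈ sector φ, g z = f z) :
    ElemCalc A φ g B := by
  obtain ⟨e, c, d, he, hfe, hB⟩ := hf
  exact ⟨e, c, d, he, fun z hz => (h z hz).trans (hfe z hz), hB⟩

lemma MemE.elemCalc (he : MemE φ e) : ElemCalc A φ e (cauchyCalc A φ e) :=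
  ⟨e, 0, 0, he, fun z _ => by simp, by simp⟩

lemma elemCalc_const (A : X →ₗ.[ℂ] X) (φ : ℝ) (c : ℂ) :
    ElemCalc A φ (fun _ => c) (c • (1 : X →L[ℂ] X)) :=
  ⟨0, c, 0, memE_zero φ, fun z _ => by simp, by simp [cauchyCalc_zero]⟩

lemma elemCalc_inv_one_add (A : X →ₗ.[ℂ] X) (φ : ℝ) :
    ElemCalc A φ (fun z => (1 + z)⁻¹) (invOneAdd A) :=
  ⟨0, 0, 1, memE_zero φ, fun z _ => by simp, by simp [cauchyCalc_zero]⟩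

lemma ElemCalc.const_mul (hf : ElemCalc A φ f B) (a : ℂ) :
    ElemCalc A φ (fun z => a * f z) (a • B) := by
  obtain ⟨e, c, d, he, hfe, rfl⟩ := hf
  refine ⟨fun z => a * e z, a * c, a * d, he.const_mul a, fun z hz => ?_, ?_⟩
  · simp only [hfe z hz]; ring
  · rw [cauchyCalc_const_mul, smul_add, smul_add, smul_smul, smul_smul]

variable (hA : IsSectorial A) (hφ : sectorialityAngle A < φ) (hφπ : φ < Real.pi)
include hA hφ hφπ

lemma ElemCalc.add (hf : ElemCalc A φ f B) (hg : ElemCalc A φ g C) :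
    ElemCalc A φ (f + g) (B + C) := by
  obtain ⟨e, c, d, he, hfe, rfl⟩ := hf
  obtain ⟨e', c', d', he', hge, rfl⟩ := hg
  refine ⟨e + e', c + c', d + d', he.add he', fun z hz => ?_, ?_⟩
  · rw [Pi.add_apply, hfe z hz, hge z hz, Pi.add_apply]; ring
  · rw [cauchyCalc_add hA hφ hφπ he he', add_smul, add_smul]
    abel

omit hA in
lemma ElemCalc.unique (hB : ElemCalc A φ f B) (hC : ElemCalc A φ f C) : B = C := by
  obtain ⟨e, c, d, he, hfe, rfl⟩ := hB
  obtain ⟨e', c', d', he', hge, rfl⟩ := hC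
  have h0 := (sectorialityAngle_nonneg A).trans_lt hφ
  obtain ⟨h1, h2⟩ := (he.add (he'.const_mul (-1))).eq_zero_of_eq_add h0 (c := c' - c)
    (d := d' - d) fun z hz => by
      have := (hfe z hz).symm.trans (hge z hz)
      rw [Pi.add_apply]
      linear_combination this
  rw [sub_eq_zero] at h1 h2
  subst h1 h2
  rw [cauchyCalc_congr hφ hφπ fun z hz => ?_]
  have := (hfe z hz).symm.trans (hge z hz)
  linear_combination this

omit hφ in
lemma ElemCalc.mono {ψ : ℝ} (hψ : sectorialityAngle A < ψ) (hψφ : ψ ≤ φ)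
    (hf : ElemCalc A φ f B) : ElemCalc A ψ f B := by
  obtain ⟨e, c, d, he, hfe, rfl⟩ := hf
  exact ⟨e, c, d, he.mono hψφ, fun z hz => hfe z (sector_mono hψφ hz), by
    rw [cauchyCalc_mono hA he hψ hψφ hφπ]⟩

variable [CompleteSpace X]

lemma MemE.elemCalc_mul_inv (he : MemE φ e) :
    ElemCalc A φ (fun z => e z * (1 + z)⁻¹) (cauchyCalc A φ e * invOneAdd A) := by
  rw [← shiftInv_one, cauchyCalc_mul_shiftInv hA hφ hφπ he one_pos]
  refine (he.mul hφπ (memHInf_div_add hφπ one_pos)).elemCalc.congr fun z _ => ?_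
  simp

lemma elemCalc_inv_mul_inv :
    ElemCalc A φ (fun z => (1 + z)⁻¹ * (1 + z)⁻¹) (invOneAdd A * invOneAdd A) := by
  refine ⟨fun z => (-1) * qFun z, 0, 1, (memE_qFun hφπ).const_mul (-1), fun z hz => ?_, ?_⟩
  · have := one_add_ne_zero_of_mem_sector hφπ hz
    simp only [qFun]
    field_simp
    ring
  · rw [cauchyCalc_const_mul, cauchyCalc_qFun hA hφ hφπ]
    simp

/-- The elementary calculus is multiplicative. -/
lemma ElemCalc.mul (hf : ElemCalc A φ f B) (hg : ElemCalc A φ g C) :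
    ElemCalc A φ (f * g) (B * C) := by
  obtain ⟨e, c, d, he, hfe, rfl⟩ := hf
  obtain ⟨e', c', d', he', hge, rfl⟩ := hg
  have h1 := (he.mul hφπ he'.1).elemCalc (A := A)
  rw [cauchyCalc_mul hA hφ hφπ he he'] at h1
  have h := ((((((((h1.add hA hφ hφπ (he.elemCalc.const_mul c')).add hA hφ hφπ
    ((he.elemCalc_mul_inv hA hφ hφπ).const_mul d')).add hA hφ hφπ
    (he'.elemCalc.const_mul c)).add hA hφ hφπ
    (elemCalc_const A φ (c * c'))).add hA hφ hφπ
    ((elemCalc_inv_one_add A φ).const_mul (c * d'))).add hA hφ hφπ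
    ((he'.elemCalc_mul_inv hA hφ hφπ).const_mul d)).add hA hφ hφπ
    ((elemCalc_inv_one_add A φ).const_mul (d * c'))).add hA hφ hφπ
    ((elemCalc_inv_mul_inv hA hφ hφπ).const_mul (d * d')))
  have hcomm := (commute_cauchyCalc_invOneAdd hA hφ hφπ he').eq
  convert h.congr (g := f * g) ?_ using 1
  · simp only [add_mul, mul_add, smul_mul_assoc, mul_smul_comm, one_mul, mul_one, hcomm]
    module
  · intro z hz
    simp only [Pi.mul_apply, Pi.add_apply, hfe z hz, hge z hz]
    ring

lemma ElemCalc.commute (hf : ElemCalc A φ f B) (hg : ElemCalc A φ g C) : Commute B C := by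
  refine ElemCalc.unique hφ hφπ (hf.mul hA hφ hφπ hg) ?_
  rw [mul_comm]
  exact hg.mul hA hφ hφπ hf

end Elementary

/-! ### Bounded operators in the extended calculus -/

/-- The function `f` belongs to the domain of the algebraic extension of the calculus on the sector
of half-angle `φ`, and its image is the bounded operator `T`. -/
def BddCalc {X : Type*} [NormedAddCommGroup X] [NormedSpace ℂ X] (A : X →ₗ.[ℂ] X) (φ : ℝ)
    (f : ℂ → ℂ) (T : X →L[ℂ] X) : Prop :=
  DifferentiableOn ℂ f (sector φ) ∧ IsAnchored A φ f ∧
    ∀ e B C, ElemCalc A φ e B → ElemCalc A φ (e * f) C → C = B * T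

section Extended

variable {X : Type*} [NormedAddCommGroup X] [NormedSpace ℂ X]
  {A : X →ₗ.[ℂ] X} {φ : ℝ} {e f g : ℂ → ℂ} {B S T : X →L[ℂ] X}

lemma extCalcGraph_iff_bddCalc :
    (∀ x y, ExtCalcGraph A φ f x y ↔ T x = y) ↔ BddCalc A φ f T := by
  constructor
  · intro h
    have h0 := (h 0 (T 0)).2 rfl
    refine ⟨h0.1, h0.2.1, fun e B C hB hC => ?_⟩
    ext x
    exact ((h x (T x)).2 rfl).2.2 e B C hB hC
  · rintro ⟨h1, h2, h3⟩ x y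
    constructor
    · rintro ⟨-, -, h4⟩
      refine sub_eq_zero.1 (h2 _ fun e B C hB hC => ?_)
      have := h4 e B C hB hC
      rw [h3 e B C hB hC] at this
      rw [map_sub, sub_eq_zero]
      exact this
    · rintro rfl
      refine ⟨h1, h2, fun e B C hB hC => ?_⟩
      rw [h3 e B C hB hC]
      rfl

lemma sectCalc_iff {ω : ℝ} : SectCalc A ω f T ↔
    ∃ φ, sectorialityAngle A < φ ∧ φ ≤ ω ∧ BddCalc A φ f T := by
  simp only [SectCalc, extCalcGraph_iff_bddCalc]

lemma BddCalc.unique (hS : BddCalc A φ f S) (hT : BddCalc A φ f T) : S = T := by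
  ext x
  refine sub_eq_zero.1 (hS.2.1 _ fun e B C hB hC => ?_)
  have h := (hS.2.2 e B C hB hC).symm.trans (hT.2.2 e B C hB hC)
  rw [map_sub, sub_eq_zero]
  exact congrArg (fun U : X →L[ℂ] X => U x) h

variable [CompleteSpace X] (hA : IsSectorial A) (hφ : sectorialityAngle A < φ)
  (hφπ : φ < Real.pi)
include hA hφ hφπ

/-- To identify the image of `f` it suffices to test with any point-separating family of
anchor elements. -/
lemma bddCalc_of_separating (hf : DifferentiableOn ℂ f (sector φ))
    (P : (ℂ → ℂ) → (X →L[ℂ] X) → (X →L[ℂ] X) → Prop)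
    (hP : ∀ e B C, P e B C → ElemCalc A φ e B ∧ ElemCalc A φ (e * f) C ∧ C = B * T)
    (hsep : ∀ x : X, (∀ e B C, P e B C → B x = 0) → x = 0) : BddCalc A φ f T := by
  refine ⟨hf, fun x hx => hsep x fun e B C h => hx e B C (hP e B C h).1 (hP e B C h).2.1,
    fun e' B' C' hB' hC' => ?_⟩
  ext x
  refine sub_eq_zero.1 (hsep _ fun e B C h => ?_)
  obtain ⟨hB, hC, rfl⟩ := hP e B C h
  have h1 := hB.mul hA hφ hφπ hC'
  have h2 := hB'.mul hA hφ hφπ hC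
  rw [mul_left_comm e' e f] at h2
  have h3 := h1.unique hφ hφπ h2
  rw [← mul_assoc, (hB'.commute hA hφ hφπ hB).eq, mul_assoc] at h3
  rw [map_sub, sub_eq_zero]
  exact congrArg (fun U : X →L[ℂ] X => U x) h3

lemma BddCalc.commute (hf : BddCalc A φ f T) (he : ElemCalc A φ e B) : Commute T B := by
  rw [commute_iff_eq]
  ext x
  refine sub_eq_zero.1 (hf.2.1 _ fun e' B' C' hB' hC' => ?_)
  have h1 := hf.2.2 e' B' C' hB' hC'
  have h2 : B' * (T * B) = B' * (B * T) := by
    rw [← mul_assoc, ← h1, (hC'.commute hA hφ hφπ he).eq, ← mul_assoc,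
      (hB'.commute hA hφ hφπ he).eq, mul_assoc, ← h1]
  rw [map_sub, sub_eq_zero]
  exact congrArg (fun U : X →L[ℂ] X => U x) h2

lemma BddCalc.mem_commutant (hf : BddCalc A φ f T) : T ∈ commutant A := by
  rw [commutant, Set.mem_centralizer_iff]
  rintro m rfl
  exact (hf.commute hA hφ hφπ (elemCalc_inv_one_add A φ)).eq.symm

omit hφ in
lemma BddCalc.mono {ψ : ℝ} (hψ : sectorialityAngle A < ψ) (hψφ : ψ ≤ φ)
    (hf : BddCalc A φ f T) : BddCalc A ψ f T := by
  refine bddCalc_of_separating hA hψ (hψφ.trans_lt hφπ) (hf.1.mono (sector_mono hψφ))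
    (fun e B C => ElemCalc A φ e B ∧ ElemCalc A φ (e * f) C) (fun e B C h => ?_)
    (fun x hx => hf.2.1 x fun e B C hB hC => hx e B C ⟨hB, hC⟩)
  exact ⟨h.1.mono hA hφπ hψ hψφ, h.2.mono hA hφπ hψ hψφ, hf.2.2 e B C h.1 h.2⟩

lemma bddCalc_const (c : ℂ) : BddCalc A φ (fun _ => c) (c • (1 : X →L[ℂ] X)) := by
  refine bddCalc_of_separating hA hφ hφπ (differentiableOn_const c)
    (fun e B C => e = 1 ∧ B = 1 ∧ C = c • (1 : X →L[ℂ] X)) ?_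
    (fun x hx => by simpa using hx 1 1 _ ⟨rfl, rfl, rfl⟩)
  rintro _ _ _ ⟨rfl, rfl, rfl⟩
  refine ⟨?_, ?_, by simp⟩
  · simpa using (elemCalc_const A φ 1).congr (g := 1) (fun z _ => rfl)
  · rw [one_mul]
    exact elemCalc_const A φ c

omit [CompleteSpace X] hA hφ hφπ in
/-- The products of an anchor element for `f` and an anchor element for `g` separate points. -/
lemma eq_zero_of_anchor_mul (hf : IsAnchored A φ f) (hg : IsAnchored A φ g) {x : X}
    (hx : ∀ e₁ B₁ C₁ e₂ B₂ C₂, ElemCalc A φ e₁ B₁ → ElemCalc A φ (e₁ * f) C₁ →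
      ElemCalc A φ e₂ B₂ → ElemCalc A φ (e₂ * g) C₂ → (B₁ * B₂) x = 0) : x = 0 :=
  hg x fun e₂ B₂ C₂ hB₂ hC₂ => hf (B₂ x) fun e₁ B₁ C₁ hB₁ hC₁ =>
    hx e₁ B₁ C₁ e₂ B₂ C₂ hB₁ hC₁ hB₂ hC₂

lemma BddCalc.add (hf : BddCalc A φ f S) (hg : BddCalc A φ g T) :
    BddCalc A φ (f + g) (S + T) := by
  refine bddCalc_of_separating hA hφ hφπ (hf.1.add hg.1)
    (fun e B C => ∃ e₁ B₁ C₁ e₂ B₂ C₂, (ElemCalc A φ e₁ B₁ ∧ ElemCalc A φ (e₁ * f) C₁ ∧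
      ElemCalc A φ e₂ B₂ ∧ ElemCalc A φ (e₂ * g) C₂) ∧
      e = e₁ * e₂ ∧ B = B₁ * B₂ ∧ C = B₂ * C₁ + B₁ * C₂) ?_
    (fun x hx => eq_zero_of_anchor_mul hf.2.1 hg.2.1
      fun e₁ B₁ C₁ e₂ B₂ C₂ h1 h2 h3 h4 =>
        hx _ _ _ ⟨e₁, B₁, C₁, e₂, B₂, C₂, ⟨h1, h2, h3, h4⟩, rfl, rfl, rfl⟩)
  rintro _ _ _ ⟨e₁, B₁, C₁, e₂, B₂, C₂, ⟨h1, h2, h3, h4⟩, rfl, rfl, rfl⟩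
  refine ⟨h1.mul hA hφ hφπ h3, ?_, ?_⟩
  · have := (h3.mul hA hφ hφπ h2).add hA hφ hφπ (h1.mul hA hφ hφπ h4)
    rwa [show e₂ * (e₁ * f) + e₁ * (e₂ * g) = e₁ * e₂ * (f + g) by ring] at this
  · rw [hf.2.2 _ _ _ h1 h2, hg.2.2 _ _ _ h3 h4, ← mul_assoc, (h3.commute hA hφ hφπ h1).eq,
      ← mul_assoc, mul_add]

lemma BddCalc.mul (hf : BddCalc A φ f S) (hg : BddCalc A φ g T) :
    BddCalc A φ (f * g) (S * T) := by
  refine bddCalc_of_separating hA hφ hφπ (hf.1.mul hg.1)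
    (fun e B C => ∃ e₁ B₁ C₁ e₂ B₂ C₂, (ElemCalc A φ e₁ B₁ ∧ ElemCalc A φ (e₁ * f) C₁ ∧
      ElemCalc A φ e₂ B₂ ∧ ElemCalc A φ (e₂ * g) C₂) ∧
      e = e₁ * e₂ ∧ B = B₁ * B₂ ∧ C = C₁ * C₂) ?_
    (fun x hx => eq_zero_of_anchor_mul hf.2.1 hg.2.1
      fun e₁ B₁ C₁ e₂ B₂ C₂ h1 h2 h3 h4 =>
        hx _ _ _ ⟨e₁, B₁, C₁, e₂, B₂, C₂, ⟨h1, h2, h3, h4⟩, rfl, rfl, rfl⟩)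
  rintro _ _ _ ⟨e₁, B₁, C₁, e₂, B₂, C₂, ⟨h1, h2, h3, h4⟩, rfl, rfl, rfl⟩
  refine ⟨h1.mul hA hφ hφπ h3, ?_, ?_⟩
  · have := h2.mul hA hφ hφπ h4
    rwa [show e₁ * f * (e₂ * g) = e₁ * e₂ * (f * g) by ring] at this
  · rw [hf.2.2 _ _ _ h1 h2, hg.2.2 _ _ _ h3 h4, mul_assoc, ← mul_assoc S,
      (hf.commute hA hφ hφπ h3).eq, mul_assoc, mul_assoc]

end Extended

section Sectorial

variable {X : Type*} [NormedAddCommGroup X] [NormedSpace ℂ X] [CompleteSpace X]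
  {A : X →ₗ.[ℂ] X} {ω : ℝ} {f g : ℂ → ℂ} {S T : X →L[ℂ] X}
  (hA : IsSectorial A) (hωπ : ω < Real.pi)
include hA hωπ

/-- Two functions can be treated on a common smaller sector. -/
lemma SectCalc.exists_common (hf : SectCalc A ω f S) (hg : SectCalc A ω g T) :
    ∃ φ, sectorialityAngle A < φ ∧ φ ≤ ω ∧ BddCalc A φ f S ∧ BddCalc A φ g T := by
  obtain ⟨φ, h1, h2, h3⟩ := sectCalc_iff.1 hf
  obtain ⟨ψ, h4, h5, h6⟩ := sectCalc_iff.1 hg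
  exact ⟨min φ ψ, lt_min h1 h4, min_le_of_left_le h2,
    h3.mono hA (h2.trans_lt hωπ) (lt_min h1 h4) (min_le_left _ _),
    h6.mono hA (h5.trans_lt hωπ) (lt_min h1 h4) (min_le_right _ _)⟩

lemma SectCalc.unique (hS : SectCalc A ω f S) (hT : SectCalc A ω f T) : S = T := by
  obtain ⟨φ, -, -, h3, h4⟩ := hS.exists_common hA hωπ hT
  exact h3.unique h4

lemma SectCalc.add (hf : SectCalc A ω f S) (hg : SectCalc A ω g T) :
    SectCalc A ω (f + g) (S + T) := by
  obtain ⟨φ, h1, h2, h3, h4⟩ := hf.exists_common hA hωπ hg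
  exact sectCalc_iff.2 ⟨φ, h1, h2, h3.add hA h1 (h2.trans_lt hωπ) h4⟩

lemma SectCalc.mul (hf : SectCalc A ω f S) (hg : SectCalc A ω g T) :
    SectCalc A ω (f * g) (S * T) := by
  obtain ⟨φ, h1, h2, h3, h4⟩ := hf.exists_common hA hωπ hg
  exact sectCalc_iff.2 ⟨φ, h1, h2, h3.mul hA h1 (h2.trans_lt hωπ) h4⟩

lemma sectCalc_const (hω : sectorialityAngle A < ω) (c : ℂ) :
    SectCalc A ω (fun _ => c) (c • (1 : X →L[ℂ] X)) :=
  sectCalc_iff.2 ⟨ω, hω, le_rfl, bddCalc_const hA hω hωπ c⟩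

lemma SectCalc.mem_commutant (hf : SectCalc A ω f T) : T ∈ commutant A := by
  obtain ⟨φ, h1, h2, h3⟩ := sectCalc_iff.1 hf
  exact h3.mem_commutant hA h1 (h2.trans_lt hωπ)

end Sectorial

/-! ### Null sequences -/

section NullSequences

variable {X : Type*} [NormedAddCommGroup X] [NormedSpace ℂ X] {A : X →ₗ.[ℂ] X}

lemma commute_of_mem_bicommutant {D T : X →L[ℂ] X} (hD : D ∈ Set.centralizer (commutant A))
    (hT : T ∈ commutant A) : Commute D T :=
  ((Set.mem_centralizer_iff.1 hD) T hT).symm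

lemma mem_commutant_iff {T : X →L[ℂ] X} : T ∈ commutant A ↔ Commute (invOneAdd A) T := by
  simp [commutant, Set.mem_centralizer_iff, commute_iff_eq]

lemma invOneAdd_mem_commutant (A : X →ₗ.[ℂ] X) : invOneAdd A ∈ commutant A :=
  mem_commutant_iff.2 (Commute.refl _)

lemma bicommutant_subset_commutant {D : X →L[ℂ] X} (hD : D ∈ Set.centralizer (commutant A)) :
    D ∈ commutant A :=
  mem_commutant_iff.2 (commute_of_mem_bicommutant hD (invOneAdd_mem_commutant A)).symm

variable [CompleteSpace X] {φ : ℝ} {f : ℂ → ℂ} {T : X →L[ℂ] X}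
  (hA : IsSectorial A) (hφ : sectorialityAngle A < φ) (hφπ : φ < Real.pi)
include hA hφ hφπ

/-- If `A` is not injective and `Φ(f)` is defined, then `f` is regular at `0`: some anchor element
does not vanish at `0`, and dividing by it transfers the integrable decay of elements of `𝓔` to
`f - f(0)`. -/
lemma BddCalc.memE_of_fixed (hf : MemHInf φ f) (hT : BddCalc A φ f T) {a : ℂ}
    (ha : Tendsto (fun t : ℝ => f t) (𝓝[>] 0) (𝓝 a)) {x₀ : X} (hx₀ : x₀ ≠ 0)
    (hfix : invOneAdd A x₀ = x₀) : MemE φ fun z => (f z - a) * (1 + z)⁻¹ := by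
  have hanch : ∃ e B C, ElemCalc A φ e B ∧ ElemCalc A φ (e * f) C ∧ B x₀ ≠ 0 := by
    by_contra! h
    exact hx₀ (hT.2.1 x₀ h)
  obtain ⟨_, _, _, ⟨e, c, d, he, hee, rfl⟩, ⟨e₁, c₁, d₁, he₁, hee₁, -⟩, hB⟩ := hanch
  have hcd : c + d ≠ 0 := by
    intro h
    apply hB
    change cauchyCalc A φ e x₀ + c • x₀ + d • invOneAdd A x₀ = 0
    rw [cauchyCalc_apply_of_fixed hA hφ hφπ he hfix, hfix, zero_add, ← add_smul, h, zero_smul]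
  have hr := memHInf_inv_one_add hφπ
  have hq := memE_qFun hφπ
  set κ := (c₁ + d₁) / (c + d) with hκ
  have hκE : MemE φ fun z => (f z - κ) * (1 + z)⁻¹ := by
    have h1 := ((((he₁.mul hφπ hr).add (hq.const_mul (-d₁))).add
      (((he.mul hφπ hf).mul hφπ hr).const_mul (-1))).add
      ((hq.mul hφπ hf).const_mul d)).const_mul (c + d)⁻¹
    refine h1.congr hφπ fun z hz => ?_
    have h2 := hee₁ z hz
    have h3 := one_add_ne_zero_of_mem_sector hφπ hz
    rw [Pi.mul_apply, hee z hz] at h2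
    have h4 : e₁ z = (e z + c + d * (1 + z)⁻¹) * f z - c₁ - d₁ * (1 + z)⁻¹ := by rw [h2]; ring
    simp only [Pi.add_apply, Pi.mul_apply, qFun, h4, hκ]
    field_simp
    ring
  have h0 := (sectorialityAngle_nonneg A).trans_lt hφ
  have h5 := hκE.eq_zero_of_tendsto_zero h0 ((ha.sub_const κ).mul tendsto_inv_one_add_zero)
  rw [mul_one, sub_eq_zero] at h5
  rwa [h5]

omit [CompleteSpace X] in
omit [CompleteSpace X] in
lemma BddCalc.cauchyCalc_add_of_memE (hT : BddCalc A φ f T) {a : ℂ}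
    (hg : MemE φ fun z => (f z - a) * (1 + z)⁻¹) :
    cauchyCalc A φ (fun z => (f z - a) * (1 + z)⁻¹) + a • invOneAdd A = invOneAdd A * T := by
  refine hT.2.2 _ _ _ (elemCalc_inv_one_add A φ) ?_
  refine (hg.elemCalc.add hA hφ hφπ ((elemCalc_inv_one_add A φ).const_mul a)).congr fun z _ => ?_
  simp only [Pi.add_apply, Pi.mul_apply]
  ring

lemma BddCalc.cauchyCalc_qFun_mul (hf : MemHInf φ f) (hT : BddCalc A φ f T) :
    cauchyCalc A φ (qFun * f) = (invOneAdd A - invOneAdd A * invOneAdd A) * T := by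
  have hq := memE_qFun hφπ
  rw [← cauchyCalc_qFun hA hφ hφπ]
  exact hT.2.2 _ _ _ hq.elemCalc (hq.mul hφπ hf).elemCalc

end NullSequences

section Closability

variable {X : Type*} [NormedAddCommGroup X] [NormedSpace ℂ X] [CompleteSpace X]
  {A : X →ₗ.[ℂ] X} {ω : ℝ} {f : ℕ → ℂ → ℂ} {Tn : ℕ → X →L[ℂ] X} {T : X →L[ℂ] X}
  (hA : IsSectorial A) (hω : sectorialityAngle A < ω) (hωπ : ω < Real.pi)
include hA hω hωπ

/-- The range of the limit consists of fixed vectors of `(1 + A)⁻¹`, that is, it lies in the kernel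
of `A`: the function `z / (1 + z)²` regularizes all `fₙ` at once. -/
lemma invOneAdd_apply_eq_of_bpConv_zero (hf : BPConv ω f 0)
    (hΦ : ∀ n, SectCalc A ω (f n) (Tn n)) (hT : TauConv A Tn T) (x : X) :
    invOneAdd A (T x) = T x := by
  set B := invOneAdd A with hB
  obtain ⟨hf1, -, hf3, C, hC⟩ := hf
  obtain ⟨-, -, 𝓓, h𝓓, hsep, hlim⟩ := hT
  have hreg : ∀ n, cauchyCalc A ω (qFun * f n) = (B - B * B) * Tn n := by
    intro n
    obtain ⟨φ, h1, h2, h3⟩ := sectCalc_iff.1 (hΦ n)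
    rw [← h3.cauchyCalc_qFun_mul hA h1 (h2.trans_lt hωπ) ((hf1 n).1.mono h2),
      cauchyCalc_mono hA ((memE_qFun hωπ).mul hωπ (hf1 n).1) h1 h2 hωπ]
  have h0 := tendsto_cauchyCalc_mul hA hω hωπ (memE_qFun hωπ) (fun n => (hf1 n).1) hC
    (fun z hz => hf3 z (mem_insert_of_mem _ hz))
  simp only [hreg] at h0
  have h1 : (B - B * B) (T x) = 0 := by
    refine hsep _ fun D hD => ?_
    have hcomm : Commute D (B - B * B) := by
      have := commute_of_mem_bicommutant (h𝓓 hD) (invOneAdd_mem_commutant A)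
      exact this.sub_right (this.mul_right this)
    have h2 : Tendsto (fun n => (B - B * B) (D (Tn n x))) atTop (𝓝 ((B - B * B) (D (T x)))) :=
      ((B - B * B).continuous.tendsto _).comp (hlim D hD x)
    have h3 : Tendsto (fun n => D (((B - B * B) * Tn n) x)) atTop (𝓝 (D ((0 : X →L[ℂ] X) x))) :=
      (D.continuous.tendsto _).comp
        (((ContinuousLinearMap.apply ℂ X x).continuous.tendsto _).comp h0)
    have h4 : ∀ y, D ((B - B * B) y) = (B - B * B) (D y) := fun y =>
      congrArg (fun U : X →L[ℂ] X => U y) hcomm.eq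
    have h5 : (fun n => D (((B - B * B) * Tn n) x)) = fun n => (B - B * B) (D (Tn n x)) := by
      funext n
      exact h4 _
    rw [h5] at h3
    rw [h4, tendsto_nhds_unique h2 h3]
    simp
  have h2 : B (T x - B (T x)) = 0 := by
    rw [map_sub]
    exact h1
  exact (sub_eq_zero.1 (invOneAdd_injective hA (hω.trans hωπ) h2)).symm

/-- Closability of the sectorial calculus. The range of the limit `T` lies in the kernel of `A`. If
this kernel is nonzero, then each `fₙ` is regular at `0`, so that `(1 + A)⁻¹ (Tₙ - fₙ(0))` is in the
range of the Cauchy integral; hence `D T x` is also in the closed subspace on which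
`t (t + A)⁻¹ → 0` as `t ↘ 0`, which meets the kernel of `A` only in `0`. -/
theorem eq_zero_of_bpConv_zero (hf : BPConv ω f 0)
    (hΦ : ∀ n, SectCalc A ω (f n) (Tn n)) (hT : TauConv A Tn T) : T = 0 := by
  have hfixT := invOneAdd_apply_eq_of_bpConv_zero hA hω hωπ hf hΦ hT
  have hπ := hω.trans hωπ
  ext x
  by_contra hx₀
  rw [zero_apply] at hx₀
  set B := invOneAdd A with hB
  obtain ⟨hf1, -, hf3, -⟩ := hf
  obtain ⟨-, -, 𝓓, h𝓓, hsep, hlim⟩ := hT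
  have hf0 : Tendsto (fun n => f n 0) atTop (𝓝 0) := hf3 0 (mem_insert _ _)
  refine hx₀ (hsep _ fun D hD => ?_)
  have hDcomm : ∀ {U : X →L[ℂ] X}, U ∈ commutant A → ∀ y, D (U y) = U (D y) := fun hU y =>
    congrArg (fun V : X →L[ℂ] X => V y) (commute_of_mem_bicommutant (h𝓓 hD) hU).eq
  have hDB := hDcomm (invOneAdd_mem_commutant A)
  rw [← hB] at hDB
  -- approximation of `D T x` by elements of the range of the Cauchy integral
  have happrox : ∀ n, ∃ φ g, sectorialityAngle A < φ ∧ φ < Real.pi ∧ MemE φ g ∧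
      cauchyCalc A φ g (D x) = B (D (Tn n x)) - f n 0 • D (B x) := by
    intro n
    obtain ⟨φ, h1, h2, h3⟩ := sectCalc_iff.1 (hΦ n)
    have h2' := h2.trans_lt hωπ
    have hg := h3.memE_of_fixed hA h1 h2' ((hf1 n).1.mono h2) (hf1 n).2 hx₀ (hfixT x)
    refine ⟨φ, _, h1, h2', hg, ?_⟩
    have h4 := eq_sub_of_add_eq (h3.cauchyCalc_add_of_memE hA h1 h2' hg)
    rw [← hDcomm (mem_commutant_iff.2 (commute_cauchyCalc_invOneAdd hA h1 h2' hg).symm), h4,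
      ← hDB, ← map_smul, ← map_sub]
    rfl
  choose φ g hφ hφπ hg hgeq using happrox
  have hlim1 : Tendsto (fun n => cauchyCalc A (φ n) (g n) (D x)) atTop (𝓝 (D (T x))) := by
    simp only [hgeq]
    have h1 := ((B.continuous.tendsto _).comp (hlim D hD x)).sub (hf0.smul_const (D (B x)))
    rw [zero_smul, sub_zero, ← hDB, hfixT] at h1
    exact h1
  have hfixD : B (D (T x)) = D (T x) := by rw [← hDB, hfixT]
  obtain ⟨M, hM⟩ := exists_norm_shiftInv_le hA hπ
  have hpos : ∀ k : ℕ, 0 < 1 / ((k : ℝ) + 1) := fun k => by positivity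
  have hbound : ∀ n, ‖D (T x)‖ ≤ M * ‖D (T x) - cauchyCalc A (φ n) (g n) (D x)‖ := by
    intro n
    set y := cauchyCalc A (φ n) (g n) (D x) with hy
    have h1 : Tendsto (fun k : ℕ => shiftInv A (1 / ((k : ℝ) + 1)) y) atTop (𝓝 0) := by
      have h2 := ((ContinuousLinearMap.apply ℂ X (D x)).continuous.tendsto _).comp
        (tendsto_cauchyCalc_mul_shiftInv hA (hφ n) (hφπ n) (hg n))
      rw [map_zero] at h2
      refine h2.congr fun k => ?_
      exact congrArg (fun V : X →L[ℂ] X => V (D x))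
        (commute_cauchyCalc_shiftInv hA (hφ n) (hφπ n) (hg n) (hpos k)).eq
    have h3 : Tendsto (fun k : ℕ => M * ‖D (T x) - y‖ + ‖shiftInv A (1 / ((k : ℝ) + 1)) y‖) atTop
        (𝓝 (M * ‖D (T x) - y‖)) := by
      simpa using h1.norm.const_add (M * ‖D (T x) - y‖)
    refine ge_of_tendsto' h3 fun k => ?_
    calc ‖D (T x)‖ = ‖shiftInv A (1 / ((k : ℝ) + 1)) (D (T x) - y)
          + shiftInv A (1 / ((k : ℝ) + 1)) y‖ := by
          rw [← map_add, sub_add_cancel, shiftInv_apply_of_fixed hA hπ (hpos k) hfixD]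
      _ ≤ _ := norm_add_le _ _
      _ ≤ _ := by
          gcongr
          exact ContinuousLinearMap.le_of_opNorm_le _ (hM _ (hpos k)) _
  have hlim2 : Tendsto (fun n => M * ‖D (T x) - cauchyCalc A (φ n) (g n) (D x)‖) atTop (𝓝 0) := by
    have := ((tendsto_const_nhds (x := D (T x))).sub hlim1).norm.const_mul M
    simpa using this
  exact norm_le_zero_iff.1 (ge_of_tendsto' hlim2 hbound)

end Closability

/-! ### Bounded pointwise convergence and `τ`-convergence -/

section Convergence

variable {ω : ℝ} {f g : ℂ → ℂ}

lemma MemHInfZero.add (hf : MemHInfZero ω f) (hg : MemHInfZero ω g) : MemHInfZero ω (f + g) :=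
  ⟨hf.1.add hg.1, hf.2.add hg.2⟩

lemma MemHInfZero.mul (hf : MemHInfZero ω f) (hg : MemHInfZero ω g) : MemHInfZero ω (f * g) :=
  ⟨hf.1.mul hg.1, Filter.Tendsto.mul hf.2 hg.2⟩

lemma memHInfZero_const (ω : ℝ) (c : ℂ) : MemHInfZero ω fun _ => c :=
  ⟨memHInf_const ω c, tendsto_const_nhds⟩

lemma bpConv_const (hf : MemHInfZero ω f) : BPConv ω (fun _ => f) f :=
  ⟨fun _ => hf, hf, fun _ _ => tendsto_const_nhds, hf.1.2.imp fun _ hC _ => hC⟩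

variable {fn gn : ℕ → ℂ → ℂ}

lemma BPConv.add (hf : BPConv ω fn f) (hg : BPConv ω gn g) :
    BPConv ω (fun n => fn n + gn n) (f + g) := by
  obtain ⟨C, hC⟩ := hf.2.2.2
  obtain ⟨D, hD⟩ := hg.2.2.2
  exact ⟨fun n => (hf.1 n).add (hg.1 n), hf.2.1.add hg.2.1,
    fun z hz => (hf.2.2.1 z hz).add (hg.2.2.1 z hz),
    C + D, fun n z hz => (norm_add_le _ _).trans (add_le_add (hC n z hz) (hD n z hz))⟩

lemma BPConv.mul (hf : BPConv ω fn f) (hg : BPConv ω gn g) :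
    BPConv ω (fun n => fn n * gn n) (f * g) := by
  obtain ⟨C, hC⟩ := hf.2.2.2
  obtain ⟨D, hD⟩ := hg.2.2.2
  refine ⟨fun n => (hf.1 n).mul (hg.1 n), hf.2.1.mul hg.2.1,
    fun z hz => (hf.2.2.1 z hz).mul (hg.2.2.1 z hz), C * D, fun n z hz => ?_⟩
  exact (norm_mul_le _ _).trans
    (mul_le_mul (hC n z hz) (hD n z hz) (norm_nonneg _) ((norm_nonneg _).trans (hC n z hz)))

variable {X : Type*} [NormedAddCommGroup X] [NormedSpace ℂ X] {A : X →ₗ.[ℂ] X}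
  {Tn Sn : ℕ → X →L[ℂ] X} {T S : X →L[ℂ] X}

lemma tauConv_const (hT : T ∈ commutant A) : TauConv A (fun _ => T) T :=
  ⟨fun _ => hT, hT, {1}, by
    rintro _ rfl
    exact Set.one_mem_centralizer, fun x hx => by simpa using hx 1 rfl,
    fun _ _ _ => tendsto_const_nhds⟩

lemma separating_mul {𝓓₁ 𝓓₂ : Set (X →L[ℂ] X)} (h₁ : ∀ x : X, (∀ D ∈ 𝓓₁, D x = 0) → x = 0)
    (h₂ : ∀ x : X, (∀ D ∈ 𝓓₂, D x = 0) → x = 0) (x : X)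
    (hx : ∀ D ∈ image2 (· * ·) 𝓓₁ 𝓓₂, D x = 0) : x = 0 :=
  h₂ x fun _ hD₂ => h₁ _ fun _ hD₁ => hx _ (mem_image2_of_mem hD₁ hD₂)

lemma TauConv.add (hT : TauConv A Tn T) (hS : TauConv A Sn S) :
    TauConv A (fun n => Tn n + Sn n) (T + S) := by
  obtain ⟨hT1, hT2, 𝓓₁, h𝓓₁, hs₁, hl₁⟩ := hT
  obtain ⟨hS1, hS2, 𝓓₂, h𝓓₂, hs₂, hl₂⟩ := hS
  refine ⟨fun n => Set.add_mem_centralizer (hT1 n) (hS1 n), Set.add_mem_centralizer hT2 hS2,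
    image2 (· * ·) 𝓓₁ 𝓓₂, ?_, separating_mul hs₁ hs₂, ?_⟩
  · rintro _ ⟨D₁, hD₁, D₂, hD₂, rfl⟩
    exact Set.mul_mem_centralizer (h𝓓₁ hD₁) (h𝓓₂ hD₂)
  · rintro _ ⟨D₁, hD₁, D₂, hD₂, rfl⟩ x
    have hc : ∀ y, D₁ (D₂ y) = D₂ (D₁ y) := fun y => congrArg (fun V : X →L[ℂ] X => V y)
      (commute_of_mem_bicommutant (h𝓓₁ hD₁) (bicommutant_subset_commutant (h𝓓₂ hD₂))).eq
    have h1 := ((D₂.continuous.tendsto _).comp (hl₁ D₁ hD₁ x)).add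
      ((D₁.continuous.tendsto _).comp (hl₂ D₂ hD₂ x))
    have h2 : ∀ U V : X →L[ℂ] X, (D₁ * D₂) ((U + V) x) = D₂ (D₁ (U x)) + D₁ (D₂ (V x)) := by
      intro U V
      rw [← hc, ← map_add, ← map_add]
      rfl
    simp only [h2]
    exact h1

lemma TauConv.mul [CompleteSpace X] (hT : TauConv A Tn T) (hS : TauConv A Sn S) :
    TauConv A (fun n => Tn n * Sn n) (T * S) := by
  obtain ⟨hT1, hT2, 𝓓₁, h𝓓₁, hs₁, hl₁⟩ := hT
  obtain ⟨hS1, hS2, 𝓓₂, h𝓓₂, hs₂, hl₂⟩ := hS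
  refine ⟨fun n => Set.mul_mem_centralizer (hT1 n) (hS1 n), Set.mul_mem_centralizer hT2 hS2,
    image2 (· * ·) 𝓓₁ 𝓓₂, ?_, separating_mul hs₁ hs₂, ?_⟩
  · rintro _ ⟨D₁, hD₁, D₂, hD₂, rfl⟩
    exact Set.mul_mem_centralizer (h𝓓₁ hD₁) (h𝓓₂ hD₂)
  · rintro _ ⟨D₁, hD₁, D₂, hD₂, rfl⟩ x
    have h1 : ∀ U V : X →L[ℂ] X, U ∈ commutant A →
        (D₁ * D₂) ((U * V) x) = (D₁ * U) (D₂ (V x)) := fun U V hU =>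
      congrArg D₁ (congrArg (fun W : X →L[ℂ] X => W (V x))
        (commute_of_mem_bicommutant (h𝓓₂ hD₂) hU).eq)
    -- strongly convergent sequences are bounded
    obtain ⟨K, hK⟩ : ∃ K, ∀ n, ‖D₁ * Tn n‖ ≤ K := by
      refine banach_steinhaus fun y => ?_
      obtain ⟨K, hK⟩ := (hl₁ D₁ hD₁ y).norm.bddAbove_range
      exact ⟨K, fun n => hK (mem_range_self n)⟩
    rw [h1 T S hT2]
    simp only [fun n => h1 (Tn n) (Sn n) (hT1 n)]
    have h2 : Tendsto (fun n => (D₁ * Tn n) (D₂ (Sn n x) - D₂ (S x))) atTop (𝓝 0) := by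
      have h3 : Tendsto (fun n => K * ‖D₂ (Sn n x) - D₂ (S x)‖) atTop (𝓝 0) := by
        simpa using ((hl₂ D₂ hD₂ x).sub_const (D₂ (S x))).norm.const_mul K
      exact squeeze_zero_norm
        (fun n => ContinuousLinearMap.le_of_opNorm_le _ (hK n) _) h3
    have h4 := h2.add (hl₁ D₁ hD₁ (D₂ (S x)))
    rw [zero_add] at h4
    refine h4.congr fun n => ?_
    rw [map_sub]
    exact sub_add_cancel _ _

end Convergence

/-! ### Topological extensions -/

/-- A closable representation has a topological extension, provided both convergence structures are
compatible with sums and products and contain the constant sequences. -/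
theorem exists_isTopExtension {F B : Type*} [Ring F] [Algebra ℂ F] [Ring B] [Algebra ℂ B]
    {E : Subalgebra ℂ F} (Φ : E →ₐ[ℂ] B) {τ₁ : (ℕ → F) → F → Prop} {τ₂ : (ℕ → B) → B → Prop}
    (hadd₁ : ∀ {e e' f f'}, τ₁ e f → τ₁ e' f' → τ₁ (fun n => e n + e' n) (f + f'))
    (hmul₁ : ∀ {e e' f f'}, τ₁ e f → τ₁ e' f' → τ₁ (fun n => e n * e' n) (f * f'))
    (hconst₁ : ∀ e : E, τ₁ (fun _ => (e : F)) e)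
    (hadd₂ : ∀ {S S' T T'}, τ₂ S T → τ₂ S' T' → τ₂ (fun n => S n + S' n) (T + T'))
    (hmul₂ : ∀ {S S' T T'}, τ₂ S T → τ₂ S' T' → τ₂ (fun n => S n * S' n) (T * T'))
    (hconst₂ : ∀ e : E, τ₂ (fun _ => Φ e) (Φ e)) (hcl : IsClosableWrt Φ τ₁ τ₂) :
    ∃ (E' : Subalgebra ℂ F) (Ψ : E' →ₐ[ℂ] B), IsTopExtension Φ Ψ τ₁ τ₂ := by
  let P : F → B → Prop := fun f T =>
    ∃ e : ℕ → E, τ₁ (fun n => (e n : F)) f ∧ τ₂ (fun n => Φ (e n)) T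
  have hPE : ∀ e : E, P e (Φ e) := fun e => ⟨fun _ => e, hconst₁ e, hconst₂ e⟩
  have hPadd : ∀ {f f' T T'}, P f T → P f' T' → P (f + f') (T + T') := by
    rintro f f' T T' ⟨e, h1, h2⟩ ⟨e', h1', h2'⟩
    exact ⟨fun n => e n + e' n, by simpa using hadd₁ h1 h1', by simpa using hadd₂ h2 h2'⟩
  have hPmul : ∀ {f f' T T'}, P f T → P f' T' → P (f * f') (T * T') := by
    rintro f f' T T' ⟨e, h1, h2⟩ ⟨e', h1', h2'⟩
    exact ⟨fun n => e n * e' n, by simpa using hmul₁ h1 h1', by simpa using hmul₂ h2 h2'⟩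
  have hPuniq : ∀ {f T T'}, P f T → P f T' → T = T' := by
    intro f T T' h h'
    have h1 := hPadd h (hPmul (hPE (-1)) h')
    obtain ⟨e, h2, h3⟩ := h1
    have h4 : f + ((-1 : E) : F) * f = 0 := by simp
    have h5 : T + Φ (-1) * T' = T - T' := by simp [sub_eq_add_neg]
    rw [h4] at h2
    rw [h5] at h3
    exact sub_eq_zero.1 (hcl e _ h2 h3)
  have hPalg : ∀ c : ℂ, P (algebraMap ℂ F c) (algebraMap ℂ B c) := fun c => by
    simpa using hPE (algebraMap ℂ E c)
  let E' : Subalgebra ℂ F :=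
    { carrier := {f | ∃ T, P f T}
      mul_mem' := by
        rintro f f' ⟨T, hT⟩ ⟨T', hT'⟩
        exact ⟨_, hPmul hT hT'⟩
      add_mem' := by
        rintro f f' ⟨T, hT⟩ ⟨T', hT'⟩
        exact ⟨_, hPadd hT hT'⟩
      algebraMap_mem' := fun c => ⟨_, hPalg c⟩ }
  have hE' : ∀ f, f ∈ E' ↔ ∃ T, P f T := fun _ => Iff.rfl
  choose! ψ hψ using fun f (hf : f ∈ E') => (hE' f).1 hf
  let Ψ : E' →ₐ[ℂ] B :=
    { toFun := fun f => ψ f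
      map_one' := hPuniq (hψ _ (one_mem E')) (by simpa using hPE 1)
      map_mul' := fun f g => hPuniq (hψ _ (mul_mem f.2 g.2)) (hPmul (hψ _ f.2) (hψ _ g.2))
      map_zero' := hPuniq (hψ _ (zero_mem E')) (by simpa using hPE 0)
      map_add' := fun f g => hPuniq (hψ _ (add_mem f.2 g.2)) (hPadd (hψ _ f.2) (hψ _ g.2))
      commutes' := fun c => hPuniq (hψ _ (Subalgebra.algebraMap_mem E' c)) (hPalg c) }
  refine ⟨E', Ψ, fun f => ?_, fun f e T h1 h2 => hPuniq (hψ _ f.2) ⟨e, h1, h2⟩,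
    fun f hf => ⟨_, hPE ⟨f, hf⟩⟩, fun f => hPuniq (hψ _ ⟨_, hPE f⟩) (hPE f)⟩
  exact (hE' f).trans exists_comm

end SectorialCalculus

end

theorem theorem10p3 {X : Type*} [NormedAddCommGroup X] [NormedSpace ℂ X] [CompleteSpace X]
    (A : X →ₗ.[ℂ] X) (hA : IsSectorial A)
    (ω : ℝ) (hω : sectorialityAngle A < ω) (hωπ : ω < Real.pi) :
    -- pointwise bounded null sequences with convergent images have limit zero
    (∀ (f : ℕ → ℂ → ℂ) (Tn : ℕ → X →L[ℂ] X) (T : X →L[ℂ] X),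
      BPConv ω f 0 → (∀ n, SectCalc A ω (f n) (Tn n)) → TauConv A Tn T → T = 0) ∧
    -- the sectorial calculus on the functions in `H^∞(S_ω ∪ {0})` with bounded `Φ_A(f)`
    ∃ (E : Subalgebra ℂ (ℂ → ℂ)) (Φ : E →ₐ[ℂ] (X →L[ℂ] X)),
      (∀ f, f ∈ E ↔ MemHInfZero ω f ∧ ∃ T, SectCalc A ω f T) ∧
      (∀ (f : E) (T : X →L[ℂ] X), SectCalc A ω f T ↔ Φ f = T) ∧
      (∀ f : E, Φ f ∈ commutant A) ∧
      -- it is closable, and its bp-extension exists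
      IsClosableWrt Φ (BPConv ω) (TauConv A) ∧
      ∃ (E' : Subalgebra ℂ (ℂ → ℂ)) (Ψ : E' →ₐ[ℂ] (X →L[ℂ] X)),
        IsTopExtension Φ Ψ (BPConv ω) (TauConv A) := by
  refine ⟨fun f Tn T => eq_zero_of_bpConv_zero hA hω hωπ, ?_⟩
  have halg : ∀ c : ℂ, SectCalc A ω (algebraMap ℂ (ℂ → ℂ) c) (algebraMap ℂ (X →L[ℂ] X) c) :=
    fun c => by
      rw [Algebra.algebraMap_eq_smul_one (A := X →L[ℂ] X)]
      exact sectCalc_const hA hωπ hω c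
  have hone : SectCalc A ω 1 (1 : X →L[ℂ] X) := by simpa using halg 1
  have hzero : SectCalc A ω 0 (0 : X →L[ℂ] X) := by simpa using halg 0
  let E : Subalgebra ℂ (ℂ → ℂ) :=
    { carrier := {f | MemHInfZero ω f ∧ ∃ T, SectCalc A ω f T}
      mul_mem' := by
        rintro f g ⟨hf, S, hS⟩ ⟨hg, T, hT⟩
        exact ⟨hf.mul hg, _, hS.mul hA hωπ hT⟩
      add_mem' := by
        rintro f g ⟨hf, S, hS⟩ ⟨hg, T, hT⟩
        exact ⟨hf.add hg, _, hS.add hA hωπ hT⟩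
      algebraMap_mem' := fun c => ⟨memHInfZero_const ω c, _, halg c⟩ }
  have hE : ∀ f, f ∈ E ↔ MemHInfZero ω f ∧ ∃ T, SectCalc A ω f T := fun _ => Iff.rfl
  choose! ψ hψ using fun f (hf : f ∈ E) => ((hE f).1 hf).2
  let Φ : E →ₐ[ℂ] (X →L[ℂ] X) :=
    { toFun := fun f => ψ f
      map_one' := (hψ _ (one_mem E)).unique hA hωπ hone
      map_mul' := fun f g =>
        (hψ _ (mul_mem f.2 g.2)).unique hA hωπ ((hψ _ f.2).mul hA hωπ (hψ _ g.2))
      map_zero' := (hψ _ (zero_mem E)).unique hA hωπ hzero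
      map_add' := fun f g =>
        (hψ _ (add_mem f.2 g.2)).unique hA hωπ ((hψ _ f.2).add hA hωπ (hψ _ g.2))
      commutes' := fun c => (hψ _ (Subalgebra.algebraMap_mem E c)).unique hA hωπ (halg c) }
  have hΦ : ∀ f : E, SectCalc A ω f (Φ f) := fun f => hψ _ f.2
  have hcomm : ∀ f : E, Φ f ∈ commutant A := fun f => (hΦ f).mem_commutant hA hωπ
  have hcl : IsClosableWrt Φ (BPConv ω) (TauConv A) := fun e T h1 h2 =>
    eq_zero_of_bpConv_zero hA hω hωπ h1 (fun n => hΦ (e n)) h2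
  refine ⟨E, Φ, hE, fun f T => ⟨fun h => (hΦ f).unique hA hωπ h, fun h => h ▸ hΦ f⟩, hcomm, hcl, ?_⟩
  exact exists_isTopExtension Φ BPConv.add BPConv.mul (fun e => bpConv_const ((hE e).1 e.2).1)
    TauConv.add TauConv.mul (fun e => tauConv_const (hcomm e)) hcl
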